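/- Let $G=(V,E,m,\mu)$ be a connected, locally finite weighted graph: $E\subseteq V\times V$ is symmetric (self-loops allowed), $m:V\to(0,\infty)$, and $\mu:E\to(0,\infty)$ is symmetric, extended by $0$ to $V\times V$. For $f,g:V\to\mathbb R$ put $$\Delta f(x)=\frac1{m(x)}\sum_{y}\mu_{xy}(f(y)-f(x)),\qquad \Gamma(f,g)=\tfrac12\big(\Delta(fg)-f\Delta g-g\Delta f\big),\qquad \Gamma_2(f,g)=\tfrac12\big(\Delta\Gamma(f,g)-\Gamma(f,\Delta g)-\Gamma(g,\Delta f)\big),$$ and write $\Gamma(f)=\Gamma(f,f)$, $\Gamma_2(f)=\Gamma_2(f,f)$. Let $P_t=e^{tL}$ $(t\ge 0)$ be the $C_0$-semigroup on $\ell^2(V,m)$ whose generator $L$ is the generator of the Dirichlet form $Q^{(D)}(f,g)=\frac12\sum_{x,y}\mu_{xy}(f(y)-f(x))(g(y)-g(x))$, where the domain of $Q^{(D)}$ is the closure of the finitely supported functions under the norm $(\|f\|_{\ell^2(V,m)}^2+Q^{(D)}(f,f))^{1/2}$. Extend $P_t$ to bounded functions by $P_tf(x)=\sum_y p_t(x,y)f(y)m(y)$,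 where $p_t(x,y)=P_t\mathbf 1_{\{y\}}(x)/m(y)$ is the heat kernel. Suppose that (i) $G$ is complete: there is a nondecreasing sequence $(\eta_k)_{k\ge1}$ of finitely supported functions on $V$ with $\eta_k\to 1$ pointwise and $\Gamma(\eta_k)\le\frac1k$ on $V$ for every $k$; (ii) $m$ is non-degenerate: $\inf_{x\in V}m(x)>0$; (iii) $G$ satisfies $CD(K,\infty)$ for some $K\in\mathbb R$: $\Gamma_2(f)(x)\ge K\,\Gamma(f)(x)$ for all $f:V\to\mathbb R$ and all $x\in V$. Then $G$ is stochastically complete, i.e. $P_t1=1$ for all $t>0$. -/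

import Mathlib

open Filter Topology
open scoped NNReal

/-- A locally finite weighted graph `(V, E, m, μ)`. The edge relation is symmetric and may contain
self-loops; `m` is a positive vertex weight; `μ` is a symmetric edge weight, positive on edges and
extended by `0` to all other pairs. -/
structure WeightedGraph (V : Type*) where
  Adj : V → V → Prop
  adj_symm : ∀ x y, Adj x y → Adj y x
  locallyFinite : ∀ x, {y | Adj x y}.Finite
  m : V → ℝ
  m_pos : ∀ x, 0 < m x
  μ : V → V → ℝ
  μ_symm : ∀ x y, μ x y = μ y x
  μ_pos : ∀ x y, Adj x y → 0 < μ x y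
  μ_eq_zero : ∀ x y, ¬ Adj x y → μ x y = 0

namespace WeightedGraph

noncomputable section

variable {V : Type*} (G : WeightedGraph V)

/-- Any two vertices are joined by a finite sequence of consecutive neighbours. -/
def Connected : Prop := ∀ x y, Relation.ReflTransGen G.Adj x y

/-- `inf m > 0`. -/
def NonDegenerate : Prop := ∃ δ : ℝ, 0 < δ ∧ ∀ x, δ ≤ G.m x

/-- The finite set of neighbours of `x`. -/
def nbrs (x : V) : Finset V := (G.locallyFinite x).toFinset

/-- The formal Laplacian `Δf(x) = (1/m(x)) ∑_{y ∼ x} μ_{xy} (f(y) - f(x))`. -/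
def lap (f : V → ℝ) (x : V) : ℝ := (1 / G.m x) * ∑ y ∈ G.nbrs x, G.μ x y * (f y - f x)

/-- The carré du champ `Γ(f,g) = ½ (Δ(fg) - fΔg - gΔf)`. -/
def gam (f g : V → ℝ) : V → ℝ :=
  (1 / 2 : ℝ) • (G.lap (f * g) - f * G.lap g - g * G.lap f)

/-- `Γ₂(f,g) = ½ (ΔΓ(f,g) - Γ(f,Δg) - Γ(g,Δf))`. -/
def gam₂ (f g : V → ℝ) : V → ℝ :=
  (1 / 2 : ℝ) • (G.lap (G.gam f g) - G.gam f (G.lap g) - G.gam g (G.lap f))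

/-- The curvature dimension condition `CD(K,∞)`: `Γ₂(f) ≥ K Γ(f)` pointwise, for all `f`. -/
def CD (K : ℝ) : Prop := ∀ (f : V → ℝ) (x : V), K * G.gam f f x ≤ G.gam₂ f f x

/-- Completeness: there is a nondecreasing sequence `η₁ ≤ η₂ ≤ ⋯` of finitely supported functions
that converges to `1` pointwise, with `Γ(η_k) ≤ 1/k` (the sequence is indexed from `0` here). -/
def IsComplete : Prop :=
  ∃ η : ℕ → V → ℝ, (∀ k, (Function.support (η k)).Finite) ∧ Monotone η ∧
    (∀ x, Tendsto (fun k => η k x) atTop (𝓝 1)) ∧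
    ∀ k x, G.gam (η k) (η k) x ≤ 1 / ((k : ℝ) + 1)

/-! ### The Hilbert space `ℓ²(V,m)` -/

/-- The square summable functions with respect to the measure `m`, as a subspace of `V → ℝ`. -/
def l2Submodule : Submodule ℝ (V → ℝ) where
  carrier := {f | Summable fun x => G.m x * f x ^ 2}
  add_mem' := by
    intro f g hf hg
    refine Summable.of_nonneg_of_le (fun x => ?_) (fun x => ?_) ((hf.mul_left 2).add (hg.mul_left 2))
    · exact mul_nonneg (G.m_pos x).le (sq_nonneg _)
    · have := G.m_pos x
      simp only [Pi.add_apply]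
      nlinarith [mul_nonneg this.le (sq_nonneg (f x - g x))]
  zero_mem' := by simp [summable_zero]
  smul_mem' := by
    intro c f hf
    refine (hf.mul_left (c ^ 2)).congr (fun x => ?_)
    simp only [Pi.smul_apply, smul_eq_mul]
    ring

/-- The space `ℓ²(V,m)`, with inner product `⟨f,g⟩ = ∑_x m(x) f(x) g(x)`. It is a type of its own,
so that it does not inherit the topology of pointwise convergence. -/
def L2 : Type _ := G.l2Submodule

instance : AddCommGroup G.L2 := inferInstanceAs (AddCommGroup G.l2Submodule)

instance : Module ℝ G.L2 := inferInstanceAs (Module ℝ G.l2Submodule)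

instance : CoeFun G.L2 (fun _ => V → ℝ) := ⟨fun f => f.1⟩

theorem L2.summable_sq (f : G.L2) : Summable fun x => G.m x * f x ^ 2 := f.2

theorem L2.summable_mul (f g : G.L2) : Summable fun x => G.m x * (f x * g x) := by
  refine Summable.of_norm_bounded ((L2.summable_sq G f).add (L2.summable_sq G g)) (fun x => ?_)
  have := (G.m_pos x).le
  rw [Real.norm_eq_abs, abs_le]
  constructor <;>
    nlinarith [mul_nonneg this (sq_nonneg (f x - g x)), mul_nonneg this (sq_nonneg (f x + g x)),
      mul_nonneg this (sq_nonneg (f x)), mul_nonneg this (sq_nonneg (g x))]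

instance l2Core : InnerProductSpace.Core ℝ G.L2 where
  inner f g := ∑' x, G.m x * (f x * g x)
  conj_inner_symm f g := by
    simp only [conj_trivial]
    exact tsum_congr fun x => by ring
  re_inner_nonneg f := by
    simp only [RCLike.re_to_real]
    exact tsum_nonneg fun x => mul_nonneg (G.m_pos x).le (mul_self_nonneg _)
  add_left f g h := by
    rw [← (L2.summable_mul G f h).tsum_add (L2.summable_mul G g h)]
    refine tsum_congr fun x => ?_
    change G.m x * ((f x + g x) * h x) = _
    ring
  smul_left f g c := by
    simp only [conj_trivial]
    rw [← tsum_mul_left]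
    refine tsum_congr fun x => ?_
    change G.m x * ((c * f x) * g x) = _
    ring
  definite f hf := by
    have h0 : ∀ x, 0 ≤ G.m x * (f x * f x) := fun x =>
      mul_nonneg (G.m_pos x).le (mul_self_nonneg _)
    have h := ((L2.summable_mul G f f).hasSum_iff.2 hf)
    rw [hasSum_zero_iff_of_nonneg h0] at h
    refine Subtype.ext (funext fun x => ?_)
    have hx : G.m x * (f x * f x) = 0 := congrFun h x
    have hx' : f x = 0 := by simpa [(G.m_pos x).ne'] using hx
    exact hx'

instance : NormedAddCommGroup G.L2 :=
  InnerProductSpace.Core.toNormedAddCommGroup (𝕜 := ℝ)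

instance : InnerProductSpace ℝ G.L2 :=
  InnerProductSpace.ofCore (G.l2Core).toCore

/-- The indicator function of `{y}` as an element of `ℓ²(V,m)`. -/
def delta (y : V) : G.L2 :=
  ⟨Set.indicator {y} 1, by
    refine summable_of_ne_finset_zero (s := {y}) (fun x hx => ?_)
    have : x ∉ ({y} : Set V) := by simpa using hx
    simp [Set.indicator_of_notMem this]⟩

/-! ### The Dirichlet form, its generator and its semigroup -/

/-- `f` has finite energy: `∑_{x,y} μ_{xy} (f(y) - f(x))² < ∞`. -/
def FiniteEnergy (f : V → ℝ) : Prop :=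
  Summable fun p : V × V => G.μ p.1 p.2 * (f p.2 - f p.1) ^ 2

/-- The energy form `Q(f,g) = ½ ∑_{x,y} μ_{xy} (f(y) - f(x)) (g(y) - g(x))`. -/
def Q (f g : V → ℝ) : ℝ :=
  (1 / 2 : ℝ) * ∑' p : V × V, G.μ p.1 p.2 * ((f p.2 - f p.1) * (g p.2 - g p.1))

/-- The domain of the Dirichlet form `Q^{(D)}`: the closure of the finitely supported functions
under `‖f‖_Q = (‖f‖² + Q(f,f))^{1/2}`. -/
def formDomain : Set G.L2 :=
  {f | G.FiniteEnergy f ∧ ∃ φ : ℕ → G.L2, (∀ n, (Function.support (φ n)).Finite) ∧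
    Tendsto (fun n => ‖f - φ n‖ ^ 2 + G.Q (f - φ n : G.L2) (f - φ n : G.L2)) atTop (𝓝 0)}

/-- The graph of the generator `L` of `Q^{(D)}`: `f ∈ D(L)` and `L f = h` if and only if
`f ∈ D(Q^{(D)})` and `Q(f,g) = -⟨h,g⟩` for all `g ∈ D(Q^{(D)})`. -/
def IsDirichletLaplacian (f h : G.L2) : Prop :=
  f ∈ G.formDomain ∧ ∀ g ∈ G.formDomain, G.Q f g = -inner ℝ h g

/-- `P` is the semigroup `e^{tL}`: a strongly continuous one-parameter semigroup of bounded
operators on `ℓ²(V,m)` whose infinitesimal generator is `L`. -/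
structure IsHeatSemigroup (P : ℝ≥0 → G.L2 →L[ℝ] G.L2) : Prop where
  map_zero : P 0 = ContinuousLinearMap.id ℝ G.L2
  map_add : ∀ s t, P (s + t) = (P s).comp (P t)
  tendsto_zero : ∀ f, Tendsto (fun t => P t f) (𝓝 0) (𝓝 f)
  generator : ∀ f h,
    Tendsto (fun t : ℝ≥0 => (t : ℝ)⁻¹ • (P t f - f)) (𝓝[>] 0) (𝓝 h) ↔ G.IsDirichletLaplacian f h

open Classical in
/-- The semigroup `P_t = e^{tL}` on `ℓ²(V,m)` associated with `Q^{(D)}`. (A strongly continuous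
semigroup is determined by its generator; the value `0` would be taken only if no such semigroup
existed.) -/
def heatSemigroup : ℝ≥0 → G.L2 →L[ℝ] G.L2 :=
  if h : ∃ P, G.IsHeatSemigroup P then h.choose else 0

/-- The heat kernel `p_t(x,y) = (P_t 1_{y})(x) / m(y)`. -/
def heatKernel (t : ℝ≥0) (x y : V) : ℝ := G.heatSemigroup t (G.delta y) x / G.m y

/-- The extension of `P_t` from `ℓ²(V,m)` to bounded functions,
`P_t f(x) = ∑_y p_t(x,y) f(y) m(y)`. -/
def heat (t : ℝ≥0) (f : V → ℝ) (x : V) : ℝ := ∑' y, G.heatKernel t x y * f y * G.m y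

/-- Stochastic completeness: `P_t 1 = 1` for all `t > 0`. -/
def StochasticallyComplete : Prop := ∀ t : ℝ≥0, 0 < t → G.heat t 1 = 1

end

end WeightedGraph

/-!
Stochastic completeness follows from a gradient estimate by an argument of Bakry: if the cutoff
functions `η_k` have small gradient, then the heat semigroup hardly moves them, so that
`P_t η_k - η_k → 0` pointwise, while `P_t η_k ≤ P_t 1 ≤ 1`; hence `P_t 1 = 1`.

The estimates are made for the resolvent `J = (1 - ε L)⁻¹`, where they are elementary. Since `m` is
bounded below, square summable functions `u` and the functions `Γ(u)` with `u` of finite energy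
exceed any positive level only finitely often, so each of them attains its supremum if that is
positive, and the maximum principle `WeightedGraph.le_of_sub_lap_le` applies without any hypothesis
at infinity.
Applied to `u = J f`, it shows that `J` is sub-Markovian. Applied to `Γ(u)`, which satisfies
`(1 + 2 K ε) Γ(u) - ε Δ Γ(u) ≤ Γ(f)` by `CD(K,∞)`, it gives
`Γ(J f) ≤ sup Γ(f) / (1 + 2 K ε)` (`WeightedGraph.CD.gam_le`). Since `J u - u = ε Δ J u` and
`|Δ u|² ≤ c Γ(u)` pointwise, iteration bounds `Jⁿ f - f` by a geometric sequence
(`WeightedGraph.abs_resolvent_pow_sub_le`).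

These bounds pass to the semigroup through the Yosida approximation: `P_t` is the strong limit of
`exp (t (n + 1) (J - 1))` with `ε = 1 / (n + 1)`, and this exponential is a Poisson average of the
powers of `J` (`apply_exp_smul_sub_one_le`). That the heat semigroup exists and is this limit is the
Hille–Yosida theorem (`IsDissipativeResolvent.exists_semigroup`) together with the uniqueness of the
semigroup with a given dissipative generator (`IsC0Semigroup.eq_of_hasGenerator_iff`). The resolvent
itself is `T T†`, where `T` is the inclusion into `ℓ²(V,m)` of the form domain, realized as the
closure of the graph of the gradient on finitely supported functions.
-/

/-! ### Exponentials of bounded operators -/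

section Exponential

variable {H : Type*} [NormedAddCommGroup H] [InnerProductSpace ℝ H] [CompleteSpace H]

open scoped Nat in
/-- The operator `exp (s (J - 1))` is the Poisson average `e⁻ˢ ∑ sⁿ/n! Jⁿ`. Hence any bound on the
orbit `Jⁿ f` tested against a continuous linear functional passes to `exp (s (J - 1)) f`. -/
theorem apply_exp_smul_sub_one_le (J : H →L[ℝ] H) (ℓ : H →L[ℝ] ℝ) (f : H) {s B B' r : ℝ}
    (hs : 0 ≤ s) (h : ∀ n : ℕ, ℓ ((J ^ n) f) ≤ B * r ^ n + B') :
    ℓ (NormedSpace.exp (s • (J - 1)) f) ≤ B * Real.exp (s * (r - 1)) + B' := by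
  have hexp : NormedSpace.exp (s • (J - 1)) = Real.exp (-s) • NormedSpace.exp (s • J) := by
    have h1 : s • (J - 1) = s • J + algebraMap ℝ (H →L[ℝ] H) (-s) := by
      rw [smul_sub, Algebra.algebraMap_eq_smul_one, neg_smul, sub_eq_add_neg]
    let _ : NormedAlgebra ℚ (H →L[ℝ] H) := NormedAlgebra.restrictScalars ℚ ℝ _
    rw [h1, NormedSpace.exp_add_of_commute (Algebra.commutes _ _).symm,
      ← NormedSpace.algebraMap_exp_comm, ← Real.exp_eq_exp_ℝ, ← Algebra.commutes,
      Algebra.algebraMap_eq_smul_one, smul_mul_assoc, one_mul]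
  have hsum : HasSum (fun n : ℕ => (n !⁻¹ : ℝ) * s ^ n * ℓ ((J ^ n) f))
      (ℓ (NormedSpace.exp (s • J) f)) := by
    have h2 := NormedSpace.exp_series_hasSum_exp' (𝕂 := ℝ) (s • J)
    have h3 := (h2.mapL (ContinuousLinearMap.apply ℝ H f)).mapL ℓ
    simpa [smul_pow, mul_assoc] using h3
  have hpow : ∀ r : ℝ, HasSum (fun n : ℕ => (n !⁻¹ : ℝ) * (s * r) ^ n) (Real.exp (s * r)) := by
    intro r
    have h2 := NormedSpace.exp_series_hasSum_exp' (𝕂 := ℝ) (s * r)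
    rw [← Real.exp_eq_exp_ℝ] at h2
    simpa using h2
  have hle : ℓ (NormedSpace.exp (s • J) f) ≤ B * Real.exp (s * r) + B' * Real.exp (s * 1) := by
    refine hasSum_le (fun n => ?_) hsum (((hpow r).mul_left B).add ((hpow 1).mul_left B'))
    have h4 : (0 : ℝ) ≤ (n !⁻¹ : ℝ) * s ^ n := by positivity
    calc _ ≤ (n !⁻¹ : ℝ) * s ^ n * (B * r ^ n + B') := mul_le_mul_of_nonneg_left (h n) h4
      _ = _ := by rw [mul_pow, mul_one]; ring
  rw [hexp]
  simp only [smul_apply, map_smul, smul_eq_mul]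
  calc _ ≤ Real.exp (-s) * (B * Real.exp (s * r) + B' * Real.exp (s * 1)) :=
        mul_le_mul_of_nonneg_left hle (Real.exp_pos _).le
    _ = B * (Real.exp (-s) * Real.exp (s * r)) + B' * (Real.exp (-s) * Real.exp (s * 1)) := by ring
    _ = _ := by
      rw [← Real.exp_add, ← Real.exp_add, mul_one, neg_add_cancel, Real.exp_zero, mul_one]
      ring_nf

theorem norm_exp_smul_sub_one_apply_le {J : H →L[ℝ] H} (hJ : ‖J‖ ≤ 1) {s : ℝ} (hs : 0 ≤ s) (f : H) :
    ‖NormedSpace.exp (s • (J - 1)) f‖ ≤ ‖f‖ := by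
  have hpow : ∀ n : ℕ, ‖(J ^ n) f‖ ≤ ‖f‖ := by
    intro n
    induction n with
    | zero => simp
    | succ n ih =>
      rw [pow_succ']
      exact (J.le_of_opNorm_le hJ _).trans (by rwa [one_mul])
  -- test against the vector `g = exp (s (J - 1)) f` itself
  set g := NormedSpace.exp (s • (J - 1)) f with hg
  have h := apply_exp_smul_sub_one_le J (innerSL ℝ g) f (B := 0) (B' := ‖g‖ * ‖f‖) (r := 1) hs
    (fun n => by
      rw [zero_mul, zero_add, innerSL_apply_apply]
      exact (real_inner_le_norm _ _).trans (mul_le_mul_of_nonneg_left (hpow n) (norm_nonneg _)))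
  rw [← hg, innerSL_apply_apply, real_inner_self_eq_norm_sq] at h
  by_contra! hlt
  nlinarith [norm_nonneg f]

/-- Two commuting bounded generators of contraction semigroups have exponentials that differ, on a vector, at
most linearly in time and in the difference of the generators on that vector. -/
theorem norm_exp_smul_sub_exp_smul_apply_le {A B : H →L[ℝ] H} (hAB : Commute A B)
    (hA : ∀ s : ℝ, 0 ≤ s → ∀ f, ‖NormedSpace.exp (s • A) f‖ ≤ ‖f‖)
    (hB : ∀ s : ℝ, 0 ≤ s → ∀ f, ‖NormedSpace.exp (s • B) f‖ ≤ ‖f‖) {t : ℝ} (ht : 0 ≤ t) (f : H) :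
    ‖NormedSpace.exp (t • A) f - NormedSpace.exp (t • B) f‖ ≤ t * ‖A f - B f‖ := by
  -- differentiate the interpolation `e^{sA} e^{(t-s)B} f`
  have hderiv : ∀ s ∈ Set.Icc (0 : ℝ) t, HasDerivWithinAt
      (fun s : ℝ => (NormedSpace.exp (s • A) * NormedSpace.exp ((t - s) • B)) f)
      ((NormedSpace.exp (s • A) * NormedSpace.exp ((t - s) • B)) (A f - B f)) (Set.Icc 0 t) s := by
    intro s _
    have h1 := hasDerivAt_exp_smul_const A s
    have h2 : HasDerivAt (fun s : ℝ => NormedSpace.exp ((t - s) • B))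
        (-(NormedSpace.exp ((t - s) • B) * B)) s := by
      have h3 := (hasDerivAt_exp_smul_const B (t - s)).scomp s ((hasDerivAt_id s).const_sub t)
      rw [neg_one_smul] at h3
      exact h3
    have h4 := (h1.mul h2).clm_apply (hasDerivAt_const s f)
    have h5 : Commute A (NormedSpace.exp ((t - s) • B)) :=
      (hAB.smul_right (t - s)).exp_right
    have h6 : NormedSpace.exp (s • A) * A * NormedSpace.exp ((t - s) • B) =
        NormedSpace.exp (s • A) * NormedSpace.exp ((t - s) • B) * A := by
      rw [mul_assoc, h5.eq, mul_assoc]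
    refine h4.hasDerivWithinAt.congr_deriv ?_
    rw [h6]
    simp [mul_assoc, sub_eq_add_neg]
  have h := norm_image_sub_le_of_norm_deriv_le_segment' hderiv (C := ‖A f - B f‖)
    (fun s hs => (hA s hs.1 _).trans (hB _ (sub_nonneg.2 hs.2.le) _)) t ⟨ht, le_rfl⟩
  simpa [mul_comm] using h

end Exponential

/-! ### Strongly continuous semigroups and their generators -/

section Semigroup

variable {H : Type*} [NormedAddCommGroup H] [InnerProductSpace ℝ H]

/-- A strongly continuous one-parameter semigroup of bounded operators. -/
structure IsC0Semigroup (P : ℝ≥0 → H →L[ℝ] H) : Prop where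
  map_zero : P 0 = ContinuousLinearMap.id ℝ H
  map_add : ∀ s t, P (s + t) = (P s).comp (P t)
  tendsto_zero : ∀ f, Tendsto (fun t => P t f) (𝓝 0) (𝓝 f)

/-- The graph of the infinitesimal generator: `P t f` has right derivative `h` at `t = 0`. -/
def HasGenerator (P : ℝ≥0 → H →L[ℝ] H) (f h : H) : Prop :=
  Tendsto (fun t : ℝ≥0 => (t : ℝ)⁻¹ • (P t f - f)) (𝓝[>] 0) (𝓝 h)

theorem HasGenerator.sub {P : ℝ≥0 → H →L[ℝ] H} {f f' h h' : H} (hf : HasGenerator P f h)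
    (hf' : HasGenerator P f' h') : HasGenerator P (f - f') (h - h') := by
  refine (Tendsto.sub hf hf').congr fun t => ?_
  rw [map_sub, ← smul_sub]
  congr 1
  abel

namespace IsC0Semigroup

variable {P : ℝ≥0 → H →L[ℝ] H} (hP : IsC0Semigroup P)

include hP

theorem map_nsmul (n : ℕ) (t : ℝ≥0) : P (n • t) = P t ^ n := by
  induction n with
  | zero => rw [zero_smul, pow_zero, hP.map_zero]; rfl
  | succ n ih => rw [succ_nsmul, hP.map_add, ih, pow_succ]; rfl

/-- By the uniform boundedness principle, a semigroup is bounded on bounded time intervals. -/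
theorem exists_norm_le [CompleteSpace H] (T : ℝ≥0) : ∃ C : ℝ, ∀ t ≤ T, ‖P t‖ ≤ C := by
  -- otherwise operators `P (t n)` of norm larger than `n` converge pointwise, with `t n → 0`
  have hloc : ∃ N : ℕ, ∀ t : ℝ≥0, t ≤ 1 / ((N : ℝ≥0) + 1) → ‖P t‖ ≤ N := by
    by_contra! hcon
    choose t ht hn using hcon
    have ht0 : Tendsto t atTop (𝓝 0) :=
      tendsto_of_tendsto_of_tendsto_of_le_of_le tendsto_const_nhds
        tendsto_one_div_add_atTop_nhds_zero_nat (fun _ => zero_le) ht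
    obtain ⟨C, hC⟩ := banach_steinhaus (g := fun n => P (t n)) (fun f => by
      have h := Metric.isBounded_range_of_tendsto _ ((hP.tendsto_zero f).comp ht0)
      obtain ⟨C, hC⟩ := h.exists_norm_le
      exact ⟨C, fun n => hC _ ⟨n, rfl⟩⟩)
    obtain ⟨n, hCn⟩ := exists_nat_gt C
    exact absurd (hC n) (not_le.2 (hCn.trans (hn n)))
  obtain ⟨N, hN⟩ := hloc
  obtain ⟨k, hk⟩ := exists_nat_gt (T * ((N : ℝ≥0) + 1))
  have hk0 : (k : ℝ≥0) ≠ 0 := (lt_of_le_of_lt zero_le hk).ne'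
  refine ⟨(N : ℝ) ^ k, fun t ht => ?_⟩
  have h1 : t = k • (t / k) := by rw [nsmul_eq_mul, mul_div_cancel₀ _ hk0]
  rw [h1, hP.map_nsmul]
  refine (norm_pow_le' _ (Nat.pos_of_ne_zero (by exact_mod_cast hk0))).trans
    (pow_le_pow_left₀ (norm_nonneg _) (hN _ ?_) _)
  rw [div_le_div_iff₀ (pos_iff_ne_zero.2 hk0) (by positivity), one_mul]
  exact (mul_le_mul_left ht _).trans hk.le

theorem hasGenerator_apply {f h : H} (hf : HasGenerator P f h) (s : ℝ≥0) :
    HasGenerator P (P s f) (P s h) := by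
  refine (((P s).continuous.tendsto h).comp hf).congr fun t => ?_
  have h1 : P s (P t f) = P t (P s f) := by
    rw [← ContinuousLinearMap.comp_apply, ← hP.map_add, add_comm, hP.map_add]; rfl
  simp [h1]

theorem hasDerivWithinAt {f h : H} (hf : HasGenerator P f h) {s : ℝ} (hs : 0 ≤ s) :
    HasDerivWithinAt (fun s : ℝ => P s.toNNReal f) (P s.toNNReal h) (Set.Ici s) s := by
  rw [hasDerivWithinAt_iff_tendsto_slope, Set.Ici_sdiff_left]
  have h1 : Tendsto (fun y : ℝ => (y - s).toNNReal) (𝓝[>] s) (𝓝[>] 0) := by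
    refine tendsto_nhdsWithin_iff.2 ⟨?_, ?_⟩
    · have h2 : Continuous fun y : ℝ => (y - s).toNNReal := by fun_prop
      simpa using h2.tendsto s |>.mono_left nhdsWithin_le_nhds
    · filter_upwards [self_mem_nhdsWithin] with y hy
      simpa using hy
  refine ((((P s.toNNReal).continuous.tendsto h).comp (hf.comp h1))).congr' ?_
  filter_upwards [self_mem_nhdsWithin] with y hy
  have hy' : 0 ≤ y - s := sub_nonneg.2 (le_of_lt hy)
  have h3 : y.toNNReal = s.toNNReal + (y - s).toNNReal := by
    rw [← Real.toNNReal_add hs hy']; congr 1; ring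
  simp [slope_def_module, h3, hP.map_add, Real.coe_toNNReal _ hy']

theorem continuousOn [CompleteSpace H] {f h : H} (hf : HasGenerator P f h) (T : ℝ) :
    ContinuousOn (fun s : ℝ => P s.toNNReal f) (Set.Icc 0 T) := by
  intro s hs
  have hright : ContinuousWithinAt (fun s : ℝ => P s.toNNReal f) (Set.Icc s T) s :=
    (hP.hasDerivWithinAt hf hs.1).continuousWithinAt.mono Set.Icc_subset_Ici_self
  have hleft : ContinuousWithinAt (fun s : ℝ => P s.toNNReal f) (Set.Icc 0 s) s := by
    obtain ⟨C, hC⟩ := hP.exists_norm_le s.toNNReal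
    have h1 : Tendsto (fun y : ℝ => C * ‖f - P (s - y).toNNReal f‖) (𝓝[Set.Icc 0 s] s) (𝓝 0) := by
      have h2 : Continuous fun y : ℝ => (s - y).toNNReal := by fun_prop
      have h3 : Tendsto (fun y : ℝ => (s - y).toNNReal) (𝓝[Set.Icc 0 s] s) (𝓝 0) := by
        simpa using (h2.tendsto s).mono_left nhdsWithin_le_nhds
      have h4 := (((hP.tendsto_zero f).comp h3).const_sub f).norm.const_mul C
      simpa using h4
    rw [ContinuousWithinAt, tendsto_iff_norm_sub_tendsto_zero]
    refine squeeze_zero' (Eventually.of_forall fun _ => norm_nonneg _) ?_ h1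
    filter_upwards [self_mem_nhdsWithin] with y hy
    have h5 : s.toNNReal = y.toNNReal + (s - y).toNNReal := by
      rw [← Real.toNNReal_add hy.1 (sub_nonneg.2 hy.2)]; congr 1; ring
    have h6 : P s.toNNReal f = P y.toNNReal (P (s - y).toNNReal f) := by rw [h5, hP.map_add]; rfl
    rw [h6, ← map_sub]
    exact (P _).le_of_opNorm_le (hC _ (Real.toNNReal_le_toNNReal hy.2)) _
  rw [← Set.Icc_union_Icc_eq_Icc hs.1 hs.2]
  exact hleft.union hright

/-- A dissipative generator with dense domain determines its semigroup: the difference of two orbits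
starting at the same point of the domain has nonincreasing norm. -/
theorem eq_of_hasGenerator_iff [CompleteSpace H] {P' : ℝ≥0 → H →L[ℝ] H} (hP' : IsC0Semigroup P')
    {D : H → H → Prop} (hD : ∀ f h, D f h → inner ℝ h f ≤ 0) (hdense : Dense {f | ∃ h, D f h})
    (hgen : ∀ f h, HasGenerator P f h ↔ D f h) (hgen' : ∀ f h, HasGenerator P' f h ↔ D f h) :
    P = P' := by
  funext T
  refine ContinuousLinearMap.coeFn_injective
    (Continuous.ext_on hdense (P T).continuous (P' T).continuous ?_)
  rintro f ⟨h, hfh⟩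
  have hf := (hgen f h).2 hfh
  have hf' := (hgen' f h).2 hfh
  have key := image_le_of_deriv_right_le_deriv_boundary (a := 0) (b := (T : ℝ)) (B := fun _ => 0)
    (B' := fun _ => 0) (f := fun s : ℝ => ‖P s.toNNReal f - P' s.toNNReal f‖ ^ 2)
    (f' := fun s : ℝ => 2 * inner ℝ (P s.toNNReal f - P' s.toNNReal f)
      (P s.toNNReal h - P' s.toNNReal h))
    (((hP.continuousOn hf T).sub (hP'.continuousOn hf' T)).norm.pow 2)
    (fun s hs => ((hP.hasDerivWithinAt hf hs.1).sub (hP'.hasDerivWithinAt hf' hs.1)).norm_sq)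
    (by simp [hP.map_zero, hP'.map_zero]) continuousOn_const
    (fun s _ => hasDerivWithinAt_const _ _ _) (fun s _ => by
      have h1 := (hgen _ _).1 (((hgen _ _).2 ((hgen' _ _).1 (hP'.hasGenerator_apply hf' s.toNNReal)))
        |> (hP.hasGenerator_apply hf s.toNNReal).sub)
      have h2 := hD _ _ h1
      rw [real_inner_comm] at h2
      linarith) (Set.right_mem_Icc.2 T.2)
  simp only [Real.toNNReal_coe] at key
  have h3 : ‖P T f - P' T f‖ = 0 := by
    have := sq_nonneg ‖P T f - P' T f‖
    exact pow_eq_zero_iff (two_ne_zero) |>.1 (le_antisymm key this)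
  exact sub_eq_zero.1 (norm_eq_zero.1 h3)

end IsC0Semigroup

end Semigroup

/-! ### Generation of contraction semigroups by Yosida approximation -/

section HilleYosida

variable {H : Type*} [NormedAddCommGroup H] [InnerProductSpace ℝ H]

/-- A uniformly bounded family of operators converges to zero pointwise if it does so on a dense
set. -/
theorem tendsto_apply_zero_of_dense {ι : Type*} {l : Filter ι} {L : ι → H →L[ℝ] H} {C : ℝ}
    (hL : ∀ᶠ i in l, ‖L i‖ ≤ C) {s : Set H} (hs : Dense s)
    (h : ∀ f ∈ s, Tendsto (fun i => L i f) l (𝓝 0)) (f : H) : Tendsto (fun i => L i f) l (𝓝 0) := by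
  rw [Metric.tendsto_nhds]
  intro ε hε
  have hC : 0 < |C| + 1 := by positivity
  obtain ⟨g, hg, hfg⟩ := hs.exists_dist_lt f (ε := ε / (2 * (|C| + 1))) (by positivity)
  filter_upwards [hL, (Metric.tendsto_nhds.1 (h g hg)) (ε / 2) (by positivity)] with i hi hig
  rw [dist_zero_right] at hig ⊢
  have h1 : L i f = L i (f - g) + L i g := by rw [map_sub]; abel
  rw [dist_eq_norm] at hfg
  have h2 : ‖L i (f - g)‖ ≤ ε / 2 := by
    calc ‖L i (f - g)‖ ≤ (|C| + 1) * ‖f - g‖ :=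
          (L i).le_of_opNorm_le (by linarith [le_abs_self C]) _
      _ ≤ (|C| + 1) * (ε / (2 * (|C| + 1))) := mul_le_mul_of_nonneg_left hfg.le hC.le
      _ = ε / 2 := by field_simp
  rw [h1]
  linarith [norm_add_le (L i (f - g)) (L i g)]

/-- The relation `D` is the graph of a densely defined dissipative operator `L`, and the operators
`J ε` satisfy `(1 - ε L) (J ε f) = f`. -/
structure IsDissipativeResolvent (D : H → H → Prop) (J : ℝ → H →L[ℝ] H) : Prop where
  sub : ∀ {f h f' h'}, D f h → D f' h' → D (f - f') (h - h')
  dissipative : ∀ {f h}, D f h → inner ℝ h f ≤ 0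
  dense : Dense {f | ∃ h, D f h}
  resolvent : ∀ {ε}, 0 < ε → ∀ f, D (J ε f) (ε⁻¹ • (J ε f - f))

/-- The Yosida approximation `(n + 1) (J (1 / (n + 1)) - 1)` of the generator. -/
noncomputable def yosida (J : ℝ → H →L[ℝ] H) (n : ℕ) : H →L[ℝ] H :=
  ((n : ℝ) + 1) • (J (1 / ((n : ℝ) + 1)) - 1)

theorem smul_yosida (J : ℝ → H →L[ℝ] H) (n : ℕ) (t : ℝ) :
    t • yosida J n = (t * (n + 1)) • (J (1 / ((n : ℝ) + 1)) - 1) := by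
  rw [yosida, smul_smul]

namespace IsDissipativeResolvent

variable {D : H → H → Prop} {J : ℝ → H →L[ℝ] H} (hJ : IsDissipativeResolvent D J)

include hJ

theorem apply_sub_smul {f h : H} (hf : D f h) {ε : ℝ} (hε : 0 < ε) : J ε (f - ε • h) = f := by
  have h1 := hJ.dissipative (hJ.sub hf (hJ.resolvent hε (f - ε • h)))
  have h2 : h - ε⁻¹ • (J ε (f - ε • h) - (f - ε • h)) = ε⁻¹ • (f - J ε (f - ε • h)) := by
    have : h = ε⁻¹ • ε • h := by rw [smul_smul, inv_mul_cancel₀ hε.ne', one_smul]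
    nth_rewrite 1 [this]
    rw [← smul_sub]
    congr 1
    abel
  rw [h2, real_inner_smul_left, real_inner_self_eq_norm_sq] at h1
  have h3 : ‖f - J ε (f - ε • h)‖ ^ 2 ≤ 0 := by
    by_contra! h4
    exact absurd h1 (not_le.2 (by positivity))
  have h5 : ‖f - J ε (f - ε • h)‖ = 0 := by
    have := sq_nonneg ‖f - J ε (f - ε • h)‖
    exact (pow_eq_zero_iff two_ne_zero).1 (le_antisymm h3 this)
  exact (sub_eq_zero.1 (norm_eq_zero.1 h5)).symm

theorem norm_le {ε : ℝ} (hε : 0 < ε) : ‖J ε‖ ≤ 1 := by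
  refine ContinuousLinearMap.opNorm_le_bound _ zero_le_one fun f => ?_
  have h1 := hJ.dissipative (hJ.resolvent hε f)
  rw [real_inner_smul_left, inner_sub_left, real_inner_self_eq_norm_sq] at h1
  have h2 : ‖J ε f‖ ^ 2 - inner ℝ f (J ε f) ≤ 0 := by
    by_contra! h4
    exact absurd h1 (not_le.2 (by positivity))
  have h3 := real_inner_le_norm f (J ε f)
  rw [one_mul]
  by_contra! hlt
  nlinarith [norm_nonneg f]

/-- The resolvent commutes with the operator. -/
theorem map_graph {f h : H} (hf : D f h) {ε : ℝ} (hε : 0 < ε) : D (J ε f) (J ε h) := by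
  have h1 := hJ.resolvent hε f
  have h2 := hJ.apply_sub_smul hf hε
  have h3 : ε⁻¹ • (J ε f - f) = J ε h := by
    nth_rewrite 2 [← h2]
    rw [map_sub, map_smul, sub_sub_cancel, smul_smul, inv_mul_cancel₀ hε.ne', one_smul]
  rwa [h3] at h1

theorem commute {ε δ : ℝ} (hε : 0 < ε) (hδ : 0 < δ) : Commute (J ε) (J δ) := by
  ext f
  have h1 := hJ.apply_sub_smul (hJ.map_graph (hJ.resolvent hδ f) hε) hδ
  rw [map_smul, smul_smul, mul_inv_cancel₀ hδ.ne', one_smul, map_sub, map_sub (J ε), map_sub (J δ),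
    sub_sub_cancel] at h1
  exact h1.symm

theorem tendsto_apply (f : H) :
    Tendsto (fun n : ℕ => J (1 / ((n : ℝ) + 1)) f) atTop (𝓝 f) := by
  have h := tendsto_apply_zero_of_dense (l := atTop)
    (L := fun n : ℕ => J (1 / ((n : ℝ) + 1)) - 1) (C := 1 + ‖(1 : H →L[ℝ] H)‖)
    (Eventually.of_forall fun n => (norm_sub_le _ _).trans
      (by gcongr; exact hJ.norm_le (by positivity))) hJ.dense (by
      rintro g ⟨h, hg⟩
      have h0 := (tendsto_one_div_add_atTop_nhds_zero_nat (𝕜 := ℝ)).mul_const ‖h‖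
      rw [zero_mul] at h0
      refine squeeze_zero_norm (fun n => ?_) h0
      have hε : (0 : ℝ) < 1 / ((n : ℝ) + 1) := by positivity
      have h1 := hJ.apply_sub_smul hg hε
      have h2 : (J (1 / ((n : ℝ) + 1)) - 1) g = (1 / ((n : ℝ) + 1)) • J (1 / ((n : ℝ) + 1)) h := by
        rw [sub_apply, one_apply_eq_self]
        nth_rewrite 2 [← h1]
        rw [map_sub, map_smul, sub_sub_cancel]
      rw [h2, norm_smul, Real.norm_of_nonneg hε.le]
      gcongr
      simpa using (J _).le_of_opNorm_le (hJ.norm_le hε) h) f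
  simpa using h.add_const f

theorem yosida_apply {f h : H} (hf : D f h) (n : ℕ) :
    yosida J n f = J (1 / ((n : ℝ) + 1)) h := by
  have hε : (0 : ℝ) < 1 / ((n : ℝ) + 1) := by positivity
  have h1 := hJ.apply_sub_smul hf hε
  rw [yosida, smul_apply, sub_apply, one_apply_eq_self]
  nth_rewrite 2 [← h1]
  rw [map_sub, map_smul, sub_sub_cancel, smul_smul, mul_one_div_cancel (by positivity), one_smul]

theorem tendsto_yosida_apply {f h : H} (hf : D f h) :
    Tendsto (fun n => yosida J n f) atTop (𝓝 h) :=
  (hJ.tendsto_apply h).congr fun n => (hJ.yosida_apply hf n).symm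

theorem commute_yosida (n m : ℕ) : Commute (yosida J n) (yosida J m) := by
  have h := hJ.commute (ε := 1 / ((n : ℝ) + 1)) (δ := 1 / ((m : ℝ) + 1)) (by positivity)
    (by positivity)
  exact (((h.sub_left (Commute.one_left _)).sub_right
    (Commute.one_right _)).smul_left _).smul_right _

variable [CompleteSpace H]

theorem norm_exp_yosida_apply_le (n : ℕ) (t : ℝ) (ht : 0 ≤ t) (f : H) :
    ‖NormedSpace.exp (t • yosida J n) f‖ ≤ ‖f‖ := by
  rw [smul_yosida]
  exact norm_exp_smul_sub_one_apply_le (hJ.norm_le (by positivity)) (by positivity) f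

theorem exists_tendsto_exp_yosida : ∃ P : ℝ≥0 → H →L[ℝ] H, ∀ (t : ℝ≥0) f,
    Tendsto (fun n => NormedSpace.exp ((t : ℝ) • yosida J n) f) atTop (𝓝 (P t f)) := by
  have hlim : ∀ (t : ℝ≥0) (f : H), ∃ g,
      Tendsto (fun n => NormedSpace.exp ((t : ℝ) • yosida J n) f) atTop (𝓝 g) := by
    intro t f
    refine cauchySeq_tendsto_of_complete (cauchySeq_iff_tendsto_dist_atTop_0.2 ?_)
    have hE : ∀ n, ‖NormedSpace.exp ((t : ℝ) • yosida J n)‖ ≤ 1 := fun n =>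
      ContinuousLinearMap.opNorm_le_bound _ zero_le_one fun f => by
        simpa using hJ.norm_exp_yosida_apply_le n t t.2 f
    have h := tendsto_apply_zero_of_dense (l := atTop) (L := fun p : ℕ × ℕ =>
      NormedSpace.exp ((t : ℝ) • yosida J p.1) - NormedSpace.exp ((t : ℝ) • yosida J p.2))
      (C := 1 + 1) (Eventually.of_forall fun p => (norm_sub_le _ _).trans
        (add_le_add (hE _) (hE _))) hJ.dense (by
        rintro g ⟨h, hg⟩
        have h0 := (cauchySeq_iff_tendsto_dist_atTop_0.1
          (hJ.tendsto_yosida_apply hg).cauchySeq).const_mul (t : ℝ)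
        rw [mul_zero] at h0
        refine squeeze_zero_norm (fun p => ?_) h0
        rw [dist_eq_norm]
        exact norm_exp_smul_sub_exp_smul_apply_le (hJ.commute_yosida _ _)
          (hJ.norm_exp_yosida_apply_le _) (hJ.norm_exp_yosida_apply_le _) t.2 g) f
    refine h.norm.congr' ?_ |>.trans (by rw [norm_zero])
    exact Eventually.of_forall fun p => (dist_eq_norm _ _).symm
  choose g hg using hlim
  refine ⟨fun t => continuousLinearMapOfTendsto (σ₁₂ := RingHom.id ℝ)
    (fun n => NormedSpace.exp ((t : ℝ) • yosida J n)) (f := g t)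
    (tendsto_pi_nhds.2 fun f => hg t f), fun t f => hg t f⟩

/-- The Hille–Yosida theorem for dissipative operators on a Hilbert space: the exponentials of the
Yosida approximations converge to a semigroup generated by the given operator. -/
theorem exists_semigroup : ∃ P : ℝ≥0 → H →L[ℝ] H, IsC0Semigroup P ∧
    (∀ f h, HasGenerator P f h ↔ D f h) ∧
    ∀ (t : ℝ≥0) f, Tendsto (fun n => NormedSpace.exp ((t : ℝ) • yosida J n) f) atTop (𝓝 (P t f)) := by
  obtain ⟨P, hP⟩ := hJ.exists_tendsto_exp_yosida
  have hcontr : ∀ t f, ‖P t f‖ ≤ ‖f‖ := fun t f =>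
    le_of_tendsto (hP t f).norm (Eventually.of_forall fun n =>
      hJ.norm_exp_yosida_apply_le n t t.2 f)
  have hbound : ∀ (t : ℝ≥0) {f h : H}, D f h → ‖P t f - f‖ ≤ t * ‖h‖ := by
    intro t f h hf
    refine le_of_tendsto ((hP t f).sub_const f).norm (Eventually.of_forall fun n => ?_)
    have h1 := norm_exp_smul_sub_exp_smul_apply_le (Commute.zero_right (yosida J n))
      (hJ.norm_exp_yosida_apply_le n) (by simp) t.2 f
    simp only [smul_zero, NormedSpace.exp_zero, one_apply_eq_self,
      zero_apply, sub_zero] at h1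
    refine h1.trans (mul_le_mul_of_nonneg_left ?_ t.2)
    rw [hJ.yosida_apply hf]
    simpa using (J _).le_of_opNorm_le (hJ.norm_le (by positivity)) h
  have happrox : ∀ (t : ℝ≥0) {f h : H} (n : ℕ), D f h →
      ‖P t f - NormedSpace.exp ((t : ℝ) • yosida J n) f‖ ≤ t * ‖h - yosida J n f‖ := by
    intro t f h n hf
    refine le_of_tendsto_of_tendsto ((hP t f).sub_const _).norm
      (((hJ.tendsto_yosida_apply hf).sub_const _).norm.const_mul _)
      (Eventually.of_forall fun m => ?_)
    exact norm_exp_smul_sub_exp_smul_apply_le (hJ.commute_yosida m n)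
      (hJ.norm_exp_yosida_apply_le m) (hJ.norm_exp_yosida_apply_le n) t.2 f
  have hsemi : IsC0Semigroup P := by
    refine ⟨?_, fun s t => ?_, fun f => ?_⟩
    · ext f
      refine tendsto_nhds_unique (hP 0 f) ?_
      simp
    · ext f
      refine tendsto_nhds_unique (hP (s + t) f) ?_
      -- `E (s + t) f = E s (E t f - P t f) + E s (P t f)`, with `E s` a contraction
      have h1 : Tendsto (fun n => NormedSpace.exp ((s : ℝ) • yosida J n)
          (NormedSpace.exp ((t : ℝ) • yosida J n) f - P t f)) atTop (𝓝 0) := by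
        refine squeeze_zero_norm (fun n => hJ.norm_exp_yosida_apply_le n s s.2 _) ?_
        simpa using ((hP t f).sub_const (P t f)).norm
      have h2 := h1.add (hP s (P t f))
      rw [zero_add] at h2
      refine h2.congr fun n => ?_
      let _ : NormedAlgebra ℚ (H →L[ℝ] H) := NormedAlgebra.restrictScalars ℚ ℝ _
      rw [NNReal.coe_add, add_smul, NormedSpace.exp_add_of_commute
        (((Commute.refl (yosida J n)).smul_left _).smul_right _), map_sub, sub_add_cancel]
      rfl
    · have h := tendsto_apply_zero_of_dense (l := 𝓝 (0 : ℝ≥0)) (L := fun t => P t - 1)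
        (C := 1 + ‖(1 : H →L[ℝ] H)‖) (Eventually.of_forall fun t => (norm_sub_le _ _).trans
          (by gcongr; exact ContinuousLinearMap.opNorm_le_bound _ zero_le_one
                fun f => by simpa using hcontr t f)) hJ.dense (by
          rintro g ⟨h, hg⟩
          have h0 : Tendsto (fun t : ℝ≥0 => (t : ℝ) * ‖h‖) (𝓝 0) (𝓝 0) := by
            have : Continuous fun t : ℝ≥0 => (t : ℝ) * ‖h‖ := by fun_prop
            simpa using this.tendsto 0
          exact squeeze_zero_norm (fun t => hbound t hg) h0) f
      simpa using h.add_const f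
  -- `P t` and `exp (t A)` differ by at most `t ‖h - A f‖` at `f`, for a Yosida approximation `A`
  have hgen : ∀ {f h : H}, D f h → HasGenerator P f h := by
    intro f h hf
    rw [HasGenerator, Metric.tendsto_nhds]
    intro ε hε
    obtain ⟨n, hn⟩ := (Metric.tendsto_nhds.1 (hJ.tendsto_yosida_apply hf) (ε / 3)
      (by positivity)).exists
    have h1 : Tendsto (fun t : ℝ≥0 => (t : ℝ)⁻¹ • (NormedSpace.exp ((t : ℝ) • yosida J n) f - f))
        (𝓝[>] 0) (𝓝 (yosida J n f)) := by
      have h2 := (hasDerivAt_exp_smul_const (yosida J n) (0 : ℝ)).clm_apply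
        (hasDerivAt_const (0 : ℝ) f)
      have h3 := (hasDerivAt_iff_tendsto_slope.1 h2)
      have h4 : Tendsto (fun t : ℝ≥0 => (t : ℝ)) (𝓝[>] 0) (𝓝[≠] 0) := by
        refine tendsto_nhdsWithin_iff.2 ⟨?_, ?_⟩
        · exact (NNReal.continuous_coe.tendsto 0).mono_left nhdsWithin_le_nhds
        · filter_upwards [self_mem_nhdsWithin] with t ht
          exact (NNReal.coe_pos.2 ht).ne'
      have h5 := h3.comp h4
      simp only [zero_smul, NormedSpace.exp_zero, one_mul, map_zero, add_zero] at h5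
      refine h5.congr fun t => ?_
      simp [slope_def_module]
    filter_upwards [Metric.tendsto_nhds.1 h1 (ε / 3) (by positivity), self_mem_nhdsWithin]
      with t ht ht0
    have ht0' : (0 : ℝ) < t := NNReal.coe_pos.2 ht0
    rw [dist_eq_norm] at hn ht ⊢
    set E := NormedSpace.exp ((t : ℝ) • yosida J n) f
    have h6 : ‖(t : ℝ)⁻¹ • (P t f - E)‖ ≤ ‖h - yosida J n f‖ := by
      rw [norm_smul, norm_inv, Real.norm_of_nonneg ht0'.le, inv_mul_le_iff₀ ht0']
      exact happrox t n hf
    have h7 : (t : ℝ)⁻¹ • (P t f - f) - h = (t : ℝ)⁻¹ • (P t f - E) +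
        ((t : ℝ)⁻¹ • (E - f) - yosida J n f) + (yosida J n f - h) := by
      have : P t f - f = (P t f - E) + (E - f) := by abel
      rw [this, smul_add]
      abel
    rw [h7]
    rw [norm_sub_rev] at h6
    linarith [norm_add₃_le (a := (t : ℝ)⁻¹ • (P t f - E))
      (b := (t : ℝ)⁻¹ • (E - f) - yosida J n f) (c := yosida J n f - h)]
  refine ⟨P, hsemi, fun f h => ⟨fun hf => ?_, hgen⟩, hP⟩
  -- the generator of a contraction semigroup is dissipative, and `1 - L` is already onto
  have h1 := hJ.resolvent one_pos (f - h)
  rw [inv_one, one_smul] at h1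
  have h2 := hf.sub (hgen h1)
  set g := J 1 (f - h)
  have h3 : h - (g - (f - h)) = f - g := by abel
  rw [h3] at h2
  have h4 : inner ℝ (f - g) (f - g) ≤ 0 := by
    refine le_of_tendsto (h2.inner (tendsto_const_nhds (x := f - g)))
      (Eventually.of_forall fun t => ?_)
    rw [real_inner_smul_left, inner_sub_left, real_inner_self_eq_norm_sq]
    have h5 := real_inner_le_norm (P t (f - g)) (f - g)
    have h6 := hcontr t (f - g)
    refine mul_nonpos_of_nonneg_of_nonpos (by positivity) ?_
    nlinarith [norm_nonneg (f - g)]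
  have h5 : f = g := by
    rw [← sub_eq_zero]
    exact real_inner_self_nonpos.1 h4
  have h6 : g - (f - h) = h := by rw [← h5]; abel
  rw [h6, ← h5] at h1
  exact h1

end IsDissipativeResolvent

end HilleYosida

/-! ### Pointwise calculus on weighted graphs -/

namespace WeightedGraph

section Calculus

variable {V : Type*} (G : WeightedGraph V)

theorem gam_apply (f g : V → ℝ) (x : V) : G.gam f g x =
    1 / (2 * G.m x) * ∑ y ∈ G.nbrs x, G.μ x y * ((f y - f x) * (g y - g x)) := by
  have h : ∑ y ∈ G.nbrs x, G.μ x y * ((f y - f x) * (g y - g x)) =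
      ∑ y ∈ G.nbrs x, G.μ x y * ((f * g) y - (f * g) x) -
        f x * ∑ y ∈ G.nbrs x, G.μ x y * (g y - g x) -
        g x * ∑ y ∈ G.nbrs x, G.μ x y * (f y - f x) := by
    rw [Finset.mul_sum, Finset.mul_sum, ← Finset.sum_sub_distrib, ← Finset.sum_sub_distrib]
    refine Finset.sum_congr rfl fun y _ => ?_
    simp only [Pi.mul_apply]
    ring
  rw [h]
  simp only [gam, lap, Pi.smul_apply, Pi.sub_apply, Pi.mul_apply, smul_eq_mul]
  have := (G.m_pos x).ne'
  field_simp

theorem μ_nonneg (x y : V) : 0 ≤ G.μ x y := by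
  by_cases h : G.Adj x y
  · exact (G.μ_pos x y h).le
  · exact (G.μ_eq_zero x y h).ge

theorem mem_nbrs {x y : V} : y ∈ G.nbrs x ↔ G.Adj x y := by simp [nbrs]

theorem μ_eq_zero_of_notMem {x y : V} (h : y ∉ G.nbrs x) : G.μ x y = 0 :=
  G.μ_eq_zero x y fun h' => h (G.mem_nbrs.2 h')

theorem gam_self_nonneg (f : V → ℝ) (x : V) : 0 ≤ G.gam f f x := by
  rw [gam_apply]
  have := G.m_pos x
  exact mul_nonneg (by positivity)
    (Finset.sum_nonneg fun y _ => mul_nonneg (G.μ_nonneg x y) (mul_self_nonneg _))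

theorem two_mul_gam_le (f g : V → ℝ) (x : V) :
    2 * G.gam f g x ≤ G.gam f f x + G.gam g g x := by
  have hm := G.m_pos x
  rw [gam_apply, gam_apply, gam_apply, ← mul_add, mul_left_comm, ← Finset.sum_add_distrib,
    Finset.mul_sum]
  refine mul_le_mul_of_nonneg_left (Finset.sum_le_sum fun y _ => ?_) (by positivity)
  nlinarith [mul_nonneg (G.μ_nonneg x y) (sq_nonneg ((f y - f x) - (g y - g x)))]

/-- Twice the weighted degree of `x` divided by `m x`. -/
noncomputable def twiceDeg (x : V) : ℝ := 2 / G.m x * ∑ y ∈ G.nbrs x, G.μ x y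

theorem lap_sq_le (f : V → ℝ) (x : V) : G.lap f x ^ 2 ≤ G.twiceDeg x * G.gam f f x := by
  have hm := G.m_pos x
  have h : (∑ y ∈ G.nbrs x, G.μ x y * (f y - f x)) ^ 2 ≤
      (∑ y ∈ G.nbrs x, G.μ x y) *
        ∑ y ∈ G.nbrs x, G.μ x y * ((f y - f x) * (f y - f x)) := by
    refine Finset.sum_sq_le_sum_mul_sum_of_sq_le_mul _ (fun y _ => G.μ_nonneg x y)
      (fun y _ => mul_nonneg (G.μ_nonneg x y) (mul_self_nonneg _)) fun y _ => le_of_eq (by ring)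
  rw [lap, gam_apply, twiceDeg, mul_pow]
  calc _ ≤ (1 / G.m x) ^ 2 * ((∑ y ∈ G.nbrs x, G.μ x y) *
        ∑ y ∈ G.nbrs x, G.μ x y * ((f y - f x) * (f y - f x))) := by gcongr
    _ = _ := by field_simp

theorem lap_nonpos_of_forall_le {f : V → ℝ} {x : V} (h : ∀ y, f y ≤ f x) : G.lap f x ≤ 0 := by
  have hm := G.m_pos x
  exact mul_nonpos_of_nonneg_of_nonpos (by positivity)
    (Finset.sum_nonpos fun y _ => mul_nonpos_of_nonneg_of_nonpos (G.μ_nonneg x y)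
      (sub_nonpos.2 (h y)))

/-- Maximum principle: a function whose positive superlevel sets are finite attains its supremum
wherever it is positive, so that a subsolution of `a w - ε Δ w = a C` is at most `C`. -/
theorem le_of_sub_lap_le {w : V → ℝ} {a ε C : ℝ} (ha : 0 < a) (hε : 0 ≤ ε) (hC : 0 ≤ C)
    (hfin : ∀ c, 0 < c → {x | c ≤ w x}.Finite) (h : ∀ x, a * w x - ε * G.lap w x ≤ a * C)
    (x : V) : w x ≤ C := by
  by_contra! hx
  obtain ⟨z, hz, hmax⟩ := Set.exists_max_image _ w (hfin (w x) (hC.trans_lt hx)) ⟨x, le_refl (w x)⟩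
  have hz' : w x ≤ w z := hz
  have hlap := G.lap_nonpos_of_forall_le (f := w) (x := z) fun y => by
    by_cases hy : w x ≤ w y
    · exact hmax y hy
    · exact (not_le.1 hy).le.trans hz'
  have h1 := h z
  have h2 : a * C < a * w z := mul_lt_mul_of_pos_left (hx.trans_le hz') ha
  nlinarith [mul_nonneg hε (neg_nonneg.2 hlap)]

variable {G}

/-- Gradient estimate for the resolvent `(1 - ε Δ) u = f`. The Bochner inequality
`Δ Γ(u) ≥ 2 Γ(u, Δ u) + 2 K Γ(u)` makes `Γ(u)` a subsolution of
`(1 + 2 K ε) Γ(u) - ε Δ Γ(u) ≤ Γ(f)`, to which the maximum principle applies. -/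
theorem CD.gam_le {K : ℝ} (hCD : G.CD K) {u f : V → ℝ} {ε C : ℝ} (hε : 0 ≤ ε)
    (hK : 0 < 1 + 2 * K * ε) (hu : ∀ x, u x - ε * G.lap u x = f x)
    (hfin : ∀ c, 0 < c → {x | c ≤ G.gam u u x}.Finite) (hf : ∀ x, G.gam f f x ≤ C) (x : V) :
    G.gam u u x ≤ C / (1 + 2 * K * ε) := by
  have hC : 0 ≤ C := (G.gam_self_nonneg f x).trans (hf x)
  refine G.le_of_sub_lap_le hK hε (div_nonneg hC hK.le) hfin (fun z => ?_) x
  rw [mul_div_cancel₀ _ hK.ne']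
  have h1 : ε * G.gam u (G.lap u) z = G.gam u u z - G.gam u f z := by
    rw [gam_apply, gam_apply, gam_apply, ← mul_sub, mul_left_comm, ← Finset.sum_sub_distrib,
      Finset.mul_sum]
    congr 1
    refine Finset.sum_congr rfl fun y _ => ?_
    rw [← hu y, ← hu z]
    ring
  have h2 : 2 * G.gam₂ u u z = G.lap (G.gam u u) z - 2 * G.gam u (G.lap u) z := by
    simp only [gam₂, Pi.smul_apply, Pi.sub_apply, smul_eq_mul]
    ring
  have h3 := mul_le_mul_of_nonneg_left (hCD u z) hε
  have h4 := G.two_mul_gam_le u f z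
  have h5 := hf z
  have h6 : ε * (2 * G.gam₂ u u z) =
      ε * G.lap (G.gam u u) z - 2 * (G.gam u u z - G.gam u f z) := by
    rw [h2, ← h1]; ring
  linarith

end Calculus

end WeightedGraph

/-! ### The Hilbert space `ℓ²(V,m)` and the form domain -/

namespace WeightedGraph

noncomputable section

variable {V : Type*} (G : WeightedGraph V)

/-- The unweighted space of square summable functions. -/
abbrev Ell2 (ι : Type*) : Type _ := lp (fun _ : ι => ℝ) 2

theorem memℓp_two_iff {ι : Type*} {f : ι → ℝ} : Memℓp f 2 ↔ Summable fun i => f i ^ 2 := by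
  rw [memℓp_gen_iff (by norm_num)]
  simp

theorem L2.inner_eq (f g : G.L2) : inner ℝ f g = ∑' x, G.m x * (f x * g x) := rfl

/-- Multiplication by `√m`, an isometry from `ℓ²(V,m)` to the unweighted space. -/
def L2.toEll2 : G.L2 →ₗᵢ[ℝ] Ell2 V :=
  LinearMap.isometryOfInner
    { toFun := fun f => ⟨fun x => √(G.m x) * f x, memℓp_two_iff.2 <| by
        refine (L2.summable_sq G f).congr fun x => ?_
        rw [mul_pow, Real.sq_sqrt (G.m_pos x).le]⟩
      map_add' := fun f g => by
        ext x
        exact mul_add _ _ _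
      map_smul' := fun c f => by
        ext x
        exact mul_left_comm _ _ _ }
    (fun f g => by
      rw [lp.inner_eq_tsum, L2.inner_eq]
      refine tsum_congr fun x => ?_
      change (√(G.m x) * g x) * (√(G.m x) * f x) = _
      rw [mul_mul_mul_comm, Real.mul_self_sqrt (G.m_pos x).le, mul_comm (g x)])

instance : CompleteSpace G.L2 := by
  have hsurj : Function.Surjective (L2.toEll2 G) := by
    intro b
    have hne : ∀ x, √(G.m x) ≠ 0 := fun x => (Real.sqrt_pos.2 (G.m_pos x)).ne'
    refine ⟨⟨fun x => (√(G.m x))⁻¹ * b x, ?_⟩, ?_⟩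
    · refine (memℓp_two_iff.1 (lp.memℓp b)).congr fun x => ?_
      rw [mul_pow, inv_pow, Real.sq_sqrt (G.m_pos x).le, mul_inv_cancel_left₀ (G.m_pos x).ne']
    · ext x
      exact mul_inv_cancel_left₀ (hne x) (b x)
  exact (LinearIsometryEquiv.ofSurjective (L2.toEll2 G) hsurj).toIsometryEquiv.completeSpace

/-- Evaluation at a vertex, as a continuous linear functional on `ℓ²(V,m)`. -/
def evalL (x : V) : G.L2 →L[ℝ] ℝ :=
  (√(G.m x))⁻¹ • (lp.evalCLM ℝ (fun _ : V => ℝ) 2 x).comp (L2.toEll2 G).toContinuousLinearMap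

@[simp]
theorem evalL_apply (x : V) (f : G.L2) : G.evalL x f = f x := by
  have h : √(G.m x) ≠ 0 := (Real.sqrt_pos.2 (G.m_pos x)).ne'
  exact inv_mul_cancel_left₀ h (f x)

@[simp]
theorem L2.sub_apply (f g : G.L2) (x : V) : (f - g : G.L2) x = f x - g x := rfl

@[simp]
theorem L2.smul_apply (c : ℝ) (f : G.L2) (x : V) : (c • f : G.L2) x = c * f x := rfl

variable {G} in
theorem L2.ext {f g : G.L2} (h : ∀ x, f x = g x) : f = g := Subtype.ext (funext h)

theorem finite_support_delta (y : V) : (Function.support (G.delta y)).Finite :=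
  (Set.finite_singleton y).subset Set.support_indicator_subset

theorem delta_apply_self (y : V) : G.delta y y = 1 :=
  Set.indicator_of_mem (Set.mem_singleton y) _

theorem delta_apply_of_ne {x y : V} (h : x ≠ y) : G.delta y x = 0 :=
  Set.indicator_of_notMem (by simpa using h) _

theorem inner_delta (f : G.L2) (y : V) : inner ℝ f (G.delta y) = G.m y * f y := by
  rw [L2.inner_eq, tsum_eq_single y, delta_apply_self, mul_one]
  intro x hx
  rw [delta_apply_of_ne G hx, mul_zero, mul_zero]

/-- `b` is the square summable edge function `c √(μ_{xy} / 2) (f(y) - f(x))`, whose squared norm is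
`c² Q(f,f)`. -/
def IsGradient (c : ℝ) (f : V → ℝ) (b : Ell2 (V × V)) : Prop :=
  ∀ p : V × V, b p = c * √(G.μ p.1 p.2 / 2) * (f p.2 - f p.1)

variable {G}

theorem IsGradient.inner {c : ℝ} {f f' : V → ℝ} {b b' : Ell2 (V × V)} (h : G.IsGradient c f b)
    (h' : G.IsGradient c f' b') : inner ℝ b b' = c ^ 2 * G.Q f f' := by
  rw [lp.inner_eq_tsum, Q, ← mul_assoc, ← tsum_mul_left]
  refine tsum_congr fun p => ?_
  rw [h p, h' p, real_inner_eq_re_inner, RCLike.inner_apply]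
  have h1 := Real.mul_self_sqrt (div_nonneg (G.μ_nonneg p.1 p.2) zero_le_two)
  simp only [conj_trivial, RCLike.re_to_real]
  linear_combination c ^ 2 * ((f p.2 - f p.1) * (f' p.2 - f' p.1)) * h1

theorem IsGradient.sub {c : ℝ} {f f' : V → ℝ} {b b' : Ell2 (V × V)} (h : G.IsGradient c f b)
    (h' : G.IsGradient c f' b') : G.IsGradient c (f - f') (b - b') := by
  intro p
  rw [lp.coeFn_sub, Pi.sub_apply, h p, h' p, Pi.sub_apply, Pi.sub_apply]
  ring

theorem IsGradient.finiteEnergy {c : ℝ} (hc : 0 < c) {f : V → ℝ} {b : Ell2 (V × V)}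
    (h : G.IsGradient c f b) : G.FiniteEnergy f := by
  refine ((memℓp_two_iff.1 (lp.memℓp b)).mul_left (2 * (c ^ 2)⁻¹)).congr fun p => ?_
  have h1 := Real.sq_sqrt (div_nonneg (G.μ_nonneg p.1 p.2) zero_le_two)
  rw [h p, mul_pow, mul_pow, h1]
  field_simp

theorem FiniteEnergy.exists_isGradient {f : V → ℝ} (h : G.FiniteEnergy f) (c : ℝ) :
    ∃ b, G.IsGradient c f b := by
  refine ⟨⟨fun p => c * √(G.μ p.1 p.2 / 2) * (f p.2 - f p.1), memℓp_two_iff.2 ?_⟩, fun p => rfl⟩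
  refine (h.mul_left (c ^ 2 / 2)).congr fun p => ?_
  have h1 := Real.sq_sqrt (div_nonneg (G.μ_nonneg p.1 p.2) zero_le_two)
  rw [mul_pow, mul_pow, h1]
  ring

theorem finiteEnergy_of_finite_support {f : V → ℝ} (hf : (Function.support f).Finite) :
    G.FiniteEnergy f := by
  -- an edge contributes only if one of its endpoints lies in the support
  have hfin : (⋃ x ∈ Function.support f, ((Prod.mk x '' {y | G.Adj x y}) ∪
      ((fun y => (y, x)) '' {y | G.Adj x y}))).Finite :=
    hf.biUnion fun x _ => ((G.locallyFinite x).image _).union ((G.locallyFinite x).image _)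
  refine summable_of_hasFiniteSupport (hfin.subset ?_)
  rintro ⟨x, y⟩ hxy
  rw [Function.mem_support] at hxy
  have hadj : G.Adj x y := by
    by_contra h
    exact hxy (by simp [G.μ_eq_zero x y h])
  by_cases hx : f x = 0
  · have hy : f y ≠ 0 := fun hy => hxy (by simp [hx, hy])
    exact Set.mem_biUnion (x := y) hy (Or.inr ⟨x, G.adj_symm _ _ hadj, rfl⟩)
  · exact Set.mem_biUnion (x := x) hx (Or.inl ⟨y, hadj, rfl⟩)

theorem mem_formDomain_of_finite_support {f : G.L2} (hf : (Function.support f).Finite) :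
    f ∈ G.formDomain := by
  refine ⟨finiteEnergy_of_finite_support hf, fun _ => f, fun _ => hf, ?_⟩
  have h : G.Q (f - f : G.L2) (f - f : G.L2) = 0 := by
    simp only [Q, L2.sub_apply]
    simp only [sub_self, mul_zero, tsum_zero]
  refine tendsto_const_nhds.congr fun n => ?_
  rw [h, sub_self, norm_zero]
  norm_num

variable (G)

/-- The pairs `(f, c √(μ/2) ∇f)` with `f` finitely supported. -/
def finiteGraph (c : ℝ) : Submodule ℝ (WithLp 2 (G.L2 × Ell2 (V × V))) where
  carrier := {k | (Function.support k.fst).Finite ∧ G.IsGradient c k.fst k.snd}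
  add_mem' := by
    rintro k k' ⟨hk, hg⟩ ⟨hk', hg'⟩
    refine ⟨(hk.union hk').subset (Function.support_add _ _), fun p => ?_⟩
    change k.snd p + k'.snd p = c * _ * ((k.fst p.2 + k'.fst p.2) - (k.fst p.1 + k'.fst p.1))
    rw [hg p, hg' p]
    ring
  zero_mem' := by
    refine ⟨?_, fun p => ?_⟩
    · have : Function.support ((0 : WithLp 2 (G.L2 × Ell2 (V × V))).fst) = ∅ :=
        Function.support_eq_empty_iff.2 rfl
      rw [this]
      exact Set.finite_empty
    · change (0 : ℝ) = c * _ * (0 - 0)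
      ring
  smul_mem' := by
    rintro a k ⟨hk, hg⟩
    refine ⟨hk.subset (Function.support_const_smul_subset a _), fun p => ?_⟩
    change a * k.snd p = c * _ * (a * k.fst p.2 - a * k.fst p.1)
    rw [hg p]
    ring

/-- The closure of `finiteGraph`: a copy of the form domain, with squared norm
`‖f‖² + c² Q(f,f)`. -/
def formGraph (c : ℝ) : Submodule ℝ (WithLp 2 (G.L2 × Ell2 (V × V))) :=
  (G.finiteGraph c).topologicalClosure

instance (c : ℝ) : CompleteSpace (G.formGraph c) :=
  (G.finiteGraph c).isClosed_topologicalClosure.completeSpace_coe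

variable {G}

theorem norm_sq_of_isGradient {c : ℝ} {k : WithLp 2 (G.L2 × Ell2 (V × V))}
    (h : G.IsGradient c k.fst k.snd) : ‖k‖ ^ 2 = ‖k.fst‖ ^ 2 + c ^ 2 * G.Q k.fst k.fst := by
  rw [WithLp.prod_norm_sq_eq_of_L2, ← h.inner h, real_inner_self_eq_norm_sq]

theorem mem_formGraph_iff {c : ℝ} (hc : 0 < c) {k : WithLp 2 (G.L2 × Ell2 (V × V))} :
    k ∈ G.formGraph c ↔ k.fst ∈ G.formDomain ∧ G.IsGradient c k.fst k.snd := by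
  constructor
  · intro hk
    have hgrad : G.IsGradient c k.fst k.snd := by
      intro p
      have hcl : IsClosed {k : WithLp 2 (G.L2 × Ell2 (V × V)) |
          lp.evalCLM ℝ (fun _ : V × V => ℝ) 2 p (WithLp.sndL 2 ℝ _ _ k) =
            c * √(G.μ p.1 p.2 / 2) * (G.evalL p.2 (WithLp.fstL 2 ℝ _ _ k) -
              G.evalL p.1 (WithLp.fstL 2 ℝ _ _ k))} :=
        isClosed_eq (by fun_prop) (by fun_prop)
      have h1 := closure_minimal (s := (G.finiteGraph c : Set _)) (fun k hk => by
        rw [Set.mem_ofPred_eq, evalL_apply, evalL_apply]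
        exact hk.2 p) hcl hk
      rw [Set.mem_ofPred_eq, evalL_apply, evalL_apply] at h1
      exact h1
    refine ⟨⟨hgrad.finiteEnergy hc, ?_⟩, hgrad⟩
    obtain ⟨κ, hκ, hlim⟩ := mem_closure_iff_seq_limit.1 hk
    refine ⟨fun n => (κ n).fst, fun n => (hκ n).1, ?_⟩
    have h1 : Tendsto (fun n => ‖k - κ n‖ ^ 2) atTop (𝓝 0) := by
      simpa using ((hlim.const_sub k).norm.pow 2)
    have h2 := h1.const_mul (1 + (c ^ 2)⁻¹)
    rw [mul_zero] at h2
    refine squeeze_zero (fun n => ?_) (fun n => ?_) h2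
    · have h3 := (hgrad.sub (hκ n).2).inner (hgrad.sub (hκ n).2)
      rw [real_inner_self_eq_norm_sq] at h3
      have h4 : 0 ≤ G.Q (k.fst - (κ n).fst : G.L2) (k.fst - (κ n).fst : G.L2) := by
        have : 0 ≤ c ^ 2 * G.Q (k.fst - (κ n).fst : G.L2) (k.fst - (κ n).fst : G.L2) :=
          h3 ▸ sq_nonneg _
        exact nonneg_of_mul_nonneg_right this (by positivity)
      positivity
    · have h3 := norm_sq_of_isGradient (k := k - κ n) (hgrad.sub (hκ n).2)
      have h4 := (hgrad.sub (hκ n).2).inner (hgrad.sub (hκ n).2)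
      rw [real_inner_self_eq_norm_sq] at h4
      change ‖k.fst - (κ n).fst‖ ^ 2 +
        G.Q (k.fst - (κ n).fst : G.L2) (k.fst - (κ n).fst : G.L2) ≤ _
      change ‖k - κ n‖ ^ 2 = ‖k.fst - (κ n).fst‖ ^ 2 +
        c ^ 2 * G.Q (k.fst - (κ n).fst : G.L2) (k.fst - (κ n).fst : G.L2) at h3
      change _ = c ^ 2 * G.Q (k.fst - (κ n).fst : G.L2) (k.fst - (κ n).fst : G.L2) at h4
      have h5 : 0 ≤ c ^ 2 * G.Q (k.fst - (κ n).fst : G.L2) (k.fst - (κ n).fst : G.L2) :=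
        h4 ▸ sq_nonneg _
      rw [h3]
      have hc2 : (c ^ 2)⁻¹ * c ^ 2 = 1 := inv_mul_cancel₀ (by positivity)
      have h6 : 0 ≤ (c ^ 2)⁻¹ * ‖k.fst - (κ n).fst‖ ^ 2 := by positivity
      linear_combination h5 + h6 -
        G.Q (k.fst - (κ n).fst : G.L2) (k.fst - (κ n).fst : G.L2) * hc2
  · rintro ⟨⟨_, φ, hφ, hlim⟩, hgrad⟩
    have hb := fun n => (finiteEnergy_of_finite_support (G := G) (hφ n)).exists_isGradient c
    choose b hb using hb
    refine mem_closure_iff_seq_limit.2 ⟨fun n => WithLp.toLp 2 (φ n, b n),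
      fun n => ⟨hφ n, hb n⟩, ?_⟩
    rw [tendsto_iff_norm_sub_tendsto_zero]
    have h2 := hlim.const_mul (1 + c ^ 2)
    rw [mul_zero] at h2
    have h3 : Tendsto (fun n => ‖k - WithLp.toLp 2 (φ n, b n)‖ ^ 2) atTop (𝓝 0) := by
      refine squeeze_zero (fun n => by positivity) (fun n => ?_) h2
      have h3 := norm_sq_of_isGradient (k := k - WithLp.toLp 2 (φ n, b n)) (hgrad.sub (hb n))
      have h4 := (hgrad.sub (hb n)).inner (hgrad.sub (hb n))
      rw [real_inner_self_eq_norm_sq] at h4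
      change _ = ‖k.fst - φ n‖ ^ 2 + c ^ 2 * G.Q (k.fst - φ n : G.L2) (k.fst - φ n : G.L2) at h3
      change _ = c ^ 2 * G.Q (k.fst - φ n : G.L2) (k.fst - φ n : G.L2) at h4
      have h5 : 0 ≤ G.Q (k.fst - φ n : G.L2) (k.fst - φ n : G.L2) :=
        nonneg_of_mul_nonneg_right (h4 ▸ sq_nonneg _) (by positivity : 0 < c ^ 2)
      rw [h3]
      have h6 : 0 ≤ c ^ 2 * ‖k.fst - φ n‖ ^ 2 := by positivity
      linear_combination h5 + h6
    have h4 := h3.sqrt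
    simp only [Real.sqrt_zero, Real.sqrt_sq (norm_nonneg _)] at h4
    exact h4.congr fun n => norm_sub_rev _ _

end

end WeightedGraph

/-! ### The resolvent of the Dirichlet Laplacian -/

namespace WeightedGraph

noncomputable section

variable {V : Type*} {G : WeightedGraph V}

theorem exists_mem_formGraph {g : G.L2} (hg : g ∈ G.formDomain) {c : ℝ} (hc : 0 < c) :
    ∃ k ∈ G.formGraph c, k.fst = g := by
  obtain ⟨b, hb⟩ := hg.1.exists_isGradient c
  exact ⟨WithLp.toLp 2 (g, b), (mem_formGraph_iff hc).2 ⟨hg, hb⟩, rfl⟩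

theorem inner_of_mem_formGraph {c : ℝ} (hc : 0 < c) {k k' : WithLp 2 (G.L2 × Ell2 (V × V))}
    (hk : k ∈ G.formGraph c) (hk' : k' ∈ G.formGraph c) :
    inner ℝ k k' = inner ℝ k.fst k'.fst + c ^ 2 * G.Q k.fst k'.fst := by
  rw [← ((mem_formGraph_iff hc).1 hk).2.inner ((mem_formGraph_iff hc).1 hk').2]
  exact WithLp.prod_inner_apply k k'

theorem sub_mem_formDomain {f f' : G.L2} (hf : f ∈ G.formDomain) (hf' : f' ∈ G.formDomain) :
    f - f' ∈ G.formDomain := by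
  obtain ⟨k, hk, rfl⟩ := exists_mem_formGraph hf one_pos
  obtain ⟨k', hk', rfl⟩ := exists_mem_formGraph hf' one_pos
  exact ((mem_formGraph_iff one_pos).1 (sub_mem hk hk')).1

theorem Q_sub_left {f f' g : G.L2} (hf : f ∈ G.formDomain) (hf' : f' ∈ G.formDomain)
    (hg : g ∈ G.formDomain) : G.Q (f - f' : G.L2) g = G.Q f g - G.Q f' g := by
  obtain ⟨b, hb⟩ := hf.1.exists_isGradient 1
  obtain ⟨b', hb'⟩ := hf'.1.exists_isGradient 1
  obtain ⟨d, hd⟩ := hg.1.exists_isGradient 1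
  have h1 := hb.inner hd
  have h2 := hb'.inner hd
  have h3 := IsGradient.inner (f := (f - f' : G.L2)) (hb.sub hb') hd
  rw [inner_sub_left, h1, h2] at h3
  linarith

theorem Q_self_nonneg (f : V → ℝ) : 0 ≤ G.Q f f :=
  mul_nonneg (by norm_num) (tsum_nonneg fun p =>
    mul_nonneg (G.μ_nonneg p.1 p.2) (mul_self_nonneg _))

/-- Green's formula against an indicator function. -/
theorem Q_delta (u : V → ℝ) (x : V) : G.Q u (G.delta x) = -(G.m x * G.lap u x) := by
  have hin : HasSum (fun p : V × V => G.μ p.1 p.2 * (u p.2 - u p.1) * G.delta x p.1)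
      (∑ y ∈ G.nbrs x, G.μ x y * (u y - u x)) := by
    rw [← (Prod.mk_right_injective x).hasSum_iff]
    · have h : HasSum (fun y => G.μ x y * (u y - u x)) (∑ y ∈ G.nbrs x, G.μ x y * (u y - u x)) :=
        hasSum_sum_of_ne_finset_zero fun y hy => by
          rw [G.μ_eq_zero_of_notMem hy, zero_mul]
      convert h using 2 with y
      simp [delta_apply_self]
    · rintro ⟨z, y⟩ hz
      have hne : z ≠ x := fun h => hz ⟨y, by rw [h]⟩
      simp only [delta_apply_of_ne G hne, mul_zero]
  have hout := ((Equiv.prodComm V V).hasSum_iff.2 hin).neg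
  have hsum : HasSum (fun p : V × V => G.μ p.1 p.2 *
      ((u p.2 - u p.1) * (G.delta x p.2 - G.delta x p.1)))
      (-(∑ y ∈ G.nbrs x, G.μ x y * (u y - u x)) - ∑ y ∈ G.nbrs x, G.μ x y * (u y - u x)) := by
    refine (congrArg (HasSum · _) (funext fun p => ?_)).mpr (hout.sub hin)
    simp only [Function.comp_apply, Equiv.prodComm_apply, Prod.fst_swap, Prod.snd_swap]
    rw [G.μ_symm p.2 p.1]
    ring
  rw [Q, hsum.tsum_eq, lap]
  have := (G.m_pos x).ne'
  field_simp
  ring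

/-- The generator acts as the formal Laplacian. -/
theorem IsDirichletLaplacian.apply_eq_lap {u h : G.L2} (hu : G.IsDirichletLaplacian u h) (x : V) :
    h x = G.lap u x := by
  have h1 := hu.2 _ (mem_formDomain_of_finite_support (G.finite_support_delta x))
  rw [Q_delta, inner_delta] at h1
  exact (mul_left_cancel₀ (G.m_pos x).ne' (neg_injective h1)).symm

variable (G)

/-- The projection of `formGraph c` to `ℓ²(V,m)`, that is, the inclusion of the form domain. -/
def formInclusion (c : ℝ) : G.formGraph c →L[ℝ] G.L2 :=
  (WithLp.fstL 2 ℝ _ _).comp (G.formGraph c).subtypeL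

/-- The resolvent `(1 - ε L)⁻¹`: the inclusion of the form domain, with the squared norm
`‖f‖² + ε Q(f,f)`, composed with its adjoint. -/
def resolvent (ε : ℝ) : G.L2 →L[ℝ] G.L2 :=
  (G.formInclusion √ε).comp (G.formInclusion √ε).adjoint

theorem inner_adjoint_formInclusion {c : ℝ} (f : G.L2)
    {k : WithLp 2 (G.L2 × Ell2 (V × V))} (hk : k ∈ G.formGraph c) :
    inner ℝ ((G.formInclusion c).adjoint f : WithLp 2 (G.L2 × Ell2 (V × V))) k =
      inner ℝ f k.fst :=
  (G.formInclusion c).adjoint_inner_left ⟨k, hk⟩ f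

theorem isDirichletLaplacian_resolvent {ε : ℝ} (hε : 0 < ε) (f : G.L2) :
    G.IsDirichletLaplacian (G.resolvent ε f) (ε⁻¹ • (G.resolvent ε f - f)) := by
  have hc : 0 < √ε := Real.sqrt_pos.2 hε
  have hk := ((G.formInclusion √ε).adjoint f).2
  refine ⟨((mem_formGraph_iff hc).1 hk).1, fun g hg => ?_⟩
  obtain ⟨k', hk', rfl⟩ := exists_mem_formGraph hg hc
  have h1 := G.inner_adjoint_formInclusion f hk'
  rw [inner_of_mem_formGraph hc hk hk', Real.sq_sqrt hε.le] at h1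
  change inner ℝ (G.resolvent ε f) k'.fst + ε * G.Q (G.resolvent ε f) k'.fst = _ at h1
  have h2 := inv_mul_cancel_left₀ hε.ne' (G.Q (G.resolvent ε f) k'.fst)
  rw [real_inner_smul_left, inner_sub_left]
  linear_combination ε⁻¹ * h1 - h2

theorem dense_isDirichletLaplacian : Dense {f | ∃ h, G.IsDirichletLaplacian f h} := by
  have hrange : Dense (Set.range (G.resolvent 1)) := by
    have h : (LinearMap.range (G.resolvent 1 : G.L2 →ₗ[ℝ] G.L2)).topologicalClosure = ⊤ := by
      rw [Submodule.topologicalClosure_eq_top_iff, Submodule.eq_bot_iff]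
      intro g hg
      set k := (G.formInclusion √1).adjoint g with hk
      -- `⟨J g, g⟩ = ‖T† g‖²` for `J = T T†`
      have h1 : inner ℝ (G.resolvent 1 g) g = (0 : ℝ) := hg _ ⟨g, rfl⟩
      have h2 : inner ℝ k k = (0 : ℝ) := by
        rw [hk, ContinuousLinearMap.adjoint_inner_left, real_inner_comm]
        exact h1
      have h3 : k = 0 := inner_self_eq_zero.1 h2
      refine L2.ext fun x => ?_
      obtain ⟨d, hd, hdx⟩ := exists_mem_formGraph
        (mem_formDomain_of_finite_support (G.finite_support_delta x))
        (Real.sqrt_pos.2 one_pos)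
      have h4 := G.inner_adjoint_formInclusion g hd
      rw [← hk, h3, hdx, inner_delta, ZeroMemClass.coe_zero, inner_zero_left] at h4
      exact (mul_eq_zero.1 h4.symm).resolve_left (G.m_pos x).ne'
    exact Submodule.dense_iff_topologicalClosure_eq_top.2 h
  refine hrange.mono ?_
  rintro _ ⟨f, rfl⟩
  exact ⟨_, G.isDirichletLaplacian_resolvent one_pos f⟩

theorem isDissipativeResolvent : IsDissipativeResolvent G.IsDirichletLaplacian G.resolvent where
  sub := fun hf hf' => ⟨sub_mem_formDomain hf.1 hf'.1, fun g hg => by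
    rw [Q_sub_left hf.1 hf'.1 hg, hf.2 g hg, hf'.2 g hg, inner_sub_left]
    ring⟩
  dissipative := fun {f h} hf => by
    have h1 := hf.2 f hf.1
    have h2 := Q_self_nonneg (G := G) f
    linarith
  dense := G.dense_isDirichletLaplacian
  resolvent := fun hε f => G.isDirichletLaplacian_resolvent hε f

/-- The heat semigroup exists, and it is the limit of the exponentials of the Yosida
approximations. -/
theorem tendsto_exp_yosida_heatSemigroup (t : ℝ≥0) (f : G.L2) :
    Tendsto (fun n => NormedSpace.exp ((t : ℝ) • yosida G.resolvent n) f) atTop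
      (𝓝 (G.heatSemigroup t f)) := by
  obtain ⟨P, hP, hgen, hlim⟩ := G.isDissipativeResolvent.exists_semigroup
  have hex : ∃ P, G.IsHeatSemigroup P :=
    ⟨P, hP.map_zero, hP.map_add, hP.tendsto_zero, hgen⟩
  have hspec : G.IsHeatSemigroup G.heatSemigroup := by
    rw [heatSemigroup, dif_pos hex]
    exact hex.choose_spec
  have heq : P = G.heatSemigroup := hP.eq_of_hasGenerator_iff
    ⟨hspec.map_zero, hspec.map_add, hspec.tendsto_zero⟩
    (fun _ _ => G.isDissipativeResolvent.dissipative) G.isDissipativeResolvent.dense hgen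
    hspec.generator
  rw [← heq]
  exact hlim t f

end

end WeightedGraph

/-! ### Bounds for the resolvent from the maximum principle -/

namespace WeightedGraph

section ResolventBounds

variable {V : Type*} {G : WeightedGraph V}

theorem finite_of_summable_of_le {ι : Type*} {a : ι → ℝ} (ha : Summable a) {s : Set ι} {c : ℝ}
    (hc : 0 < c) (h : ∀ x ∈ s, c ≤ a x) : s.Finite := by
  have h1 := ha.tendsto_cofinite_zero.eventually_lt_const hc
  rw [eventually_cofinite] at h1
  exact h1.subset fun x hx => not_lt.2 (h x hx)

/-- Square summable functions exceed a positive level only finitely often, as `m` is bounded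
below. -/
theorem NonDegenerate.finite_le (hm : G.NonDegenerate) (f : G.L2) {c : ℝ} (hc : 0 < c) :
    {x | c ≤ f x}.Finite := by
  obtain ⟨δ, hδ, hδm⟩ := hm
  refine finite_of_summable_of_le (L2.summable_sq G f) (c := δ * c ^ 2) (by positivity)
    fun x hx => ?_
  have hx' : c ≤ f x := hx
  have := G.m_pos x
  gcongr
  exact hδm x

theorem NonDegenerate.finite_le_gam (hm : G.NonDegenerate) {f : V → ℝ} (hf : G.FiniteEnergy f)
    {c : ℝ} (hc : 0 < c) : {x | c ≤ G.gam f f x}.Finite := by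
  obtain ⟨δ, hδ, hδm⟩ := hm
  refine finite_of_summable_of_le hf.prod (c := 2 * δ * c) (by positivity) fun x hx => ?_
  have hx' : c ≤ G.gam f f x := hx
  have hpos := G.m_pos x
  have h1 : ∑' y, G.μ x y * (f y - f x) ^ 2 = 2 * G.m x * G.gam f f x := by
    rw [tsum_eq_sum (s := G.nbrs x) fun y hy => by rw [G.μ_eq_zero_of_notMem hy, zero_mul],
      gam_apply]
    simp only [pow_two]
    field_simp
  rw [h1]
  gcongr
  exact hδm x

theorem resolvent_sub_lap {ε : ℝ} (hε : 0 < ε) (f : G.L2) (x : V) :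
    G.resolvent ε f x - ε * G.lap (G.resolvent ε f) x = f x := by
  rw [← (G.isDirichletLaplacian_resolvent hε f).apply_eq_lap x, L2.smul_apply, L2.sub_apply,
    mul_inv_cancel_left₀ hε.ne']
  ring

theorem NonDegenerate.resolvent_le (hm : G.NonDegenerate) {ε C : ℝ} (hε : 0 < ε) (hC : 0 ≤ C)
    {f : G.L2} (hf : ∀ x, f x ≤ C) (x : V) : G.resolvent ε f x ≤ C :=
  G.le_of_sub_lap_le one_pos hε.le hC (fun _ hc => hm.finite_le _ hc)
    (fun z => by rw [one_mul, one_mul, resolvent_sub_lap hε]; exact hf z) x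

theorem NonDegenerate.resolvent_pow_le (hm : G.NonDegenerate) {ε C : ℝ} (hε : 0 < ε) (hC : 0 ≤ C)
    {f : G.L2} (hf : ∀ x, f x ≤ C) (n : ℕ) (x : V) : (G.resolvent ε ^ n) f x ≤ C := by
  induction n generalizing x with
  | zero => exact hf x
  | succ n ih =>
    rw [pow_succ']
    exact hm.resolvent_le hε hC ih x

theorem gam_resolvent_pow_le (hm : G.NonDegenerate) {K ε r : ℝ} (hCD : G.CD K) (hε : 0 < ε)
    (hK : 0 < 1 + 2 * K * ε) (hr : 1 ≤ r ^ 2 * (1 + 2 * K * ε)) {C : ℝ} {f : G.L2}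
    (hf : ∀ x, G.gam f f x ≤ C ^ 2) (n : ℕ) (x : V) :
    G.gam ((G.resolvent ε ^ n) f) ((G.resolvent ε ^ n) f) x ≤ (C * r ^ n) ^ 2 := by
  induction n generalizing x with
  | zero => simpa using hf x
  | succ n ih =>
    rw [pow_succ']
    refine (hCD.gam_le hε.le hK (resolvent_sub_lap hε _) (fun c hc => hm.finite_le_gam
      (G.isDirichletLaplacian_resolvent hε _).1.1 hc) ih x).trans ?_
    rw [div_le_iff₀ hK]
    calc (C * r ^ n) ^ 2 = (C * r ^ n) ^ 2 * 1 := (mul_one _).symm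
      _ ≤ (C * r ^ n) ^ 2 * (r ^ 2 * (1 + 2 * K * ε)) :=
        mul_le_mul_of_nonneg_left hr (sq_nonneg _)
      _ = _ := by ring

/-- The orbit of the resolvent moves by at most `ε |Δ|` in each step, which the gradient estimate
bounds by a geometric sequence. -/
theorem abs_resolvent_pow_sub_le (hm : G.NonDegenerate) {K κ ε : ℝ} (hCD : G.CD K) (hε : 0 < ε)
    (hκ : 0 < κ) (hκK : 2 * |K| ≤ κ) (hκε : κ * ε ≤ 1 / 2) {C : ℝ} (hC : 0 ≤ C) {f : G.L2}
    (hf : ∀ x, G.gam f f x ≤ C ^ 2) (n : ℕ) (x : V) :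
    |(G.resolvent ε ^ n) f x - f x| ≤
      √(G.twiceDeg x) * C / κ * ((1 / (1 - κ * ε)) ^ n - 1) := by
  set r := 1 / (1 - κ * ε) with hr
  have hκε0 : 0 < κ * ε := by positivity
  have hpos : 0 < 1 - κ * ε := by linarith
  have hr0 : 0 < r := by positivity
  have hrmul : r * (1 - κ * ε) = 1 := one_div_mul_cancel hpos.ne'
  have hrsub : r - 1 = κ * ε * r := by linarith
  have hKε : -(κ * ε) ≤ 2 * K * ε := by
    have := neg_abs_le K
    nlinarith
  -- so `r = 1 / (1 - κ ε)` bounds the factor by which one step increases `√Γ`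
  have hK : (1 - κ * ε) ^ 2 ≤ 1 + 2 * K * ε := by nlinarith
  have hr2 : 1 ≤ r ^ 2 * (1 + 2 * K * ε) := by
    calc (1 : ℝ) = r ^ 2 * (1 - κ * ε) ^ 2 := by rw [← mul_pow, hrmul, one_pow]
      _ ≤ _ := by gcongr
  have hgam := gam_resolvent_pow_le hm hCD hε (lt_of_lt_of_le (by positivity) hK) hr2 hf
  have hdeg : 0 ≤ G.twiceDeg x := by
    have := G.m_pos x
    exact mul_nonneg (by positivity) (Finset.sum_nonneg fun y _ => G.μ_nonneg x y)
  induction n with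
  | zero => simp
  | succ n ih =>
    have hlap : |G.lap ((G.resolvent ε ^ (n + 1)) f) x| ≤
        √(G.twiceDeg x) * (C * r ^ (n + 1)) := by
      refine abs_le_of_sq_le_sq ?_ (by positivity)
      rw [mul_pow, Real.sq_sqrt hdeg]
      exact (G.lap_sq_le _ x).trans (mul_le_mul_of_nonneg_left (hgam (n + 1) x) hdeg)
    have hstep : (G.resolvent ε ^ (n + 1)) f x - (G.resolvent ε ^ n) f x =
        ε * G.lap ((G.resolvent ε ^ (n + 1)) f) x := by
      have h1 := resolvent_sub_lap hε ((G.resolvent ε ^ n) f) x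
      rw [pow_succ']
      exact sub_eq_of_eq_add' (eq_add_of_sub_eq h1)
    have h1 : |(G.resolvent ε ^ (n + 1)) f x - (G.resolvent ε ^ n) f x| ≤
        √(G.twiceDeg x) * C / κ * (r ^ (n + 1) - r ^ n) := by
      rw [hstep, abs_mul, abs_of_pos hε]
      have h2 : r ^ (n + 1) - r ^ n = κ * ε * r ^ (n + 1) := by
        rw [pow_succ]; linear_combination r ^ n * hrsub
      calc _ ≤ ε * (√(G.twiceDeg x) * (C * r ^ (n + 1))) := by gcongr
        _ = _ := by rw [h2]; field_simp
    calc _ ≤ |(G.resolvent ε ^ (n + 1)) f x - (G.resolvent ε ^ n) f x| +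
          |(G.resolvent ε ^ n) f x - f x| := abs_sub_le _ _ _
      _ ≤ _ := by linarith

end ResolventBounds

/-! ### Bounds for the heat semigroup and stochastic completeness -/

section Heat

variable {V : Type*} {G : WeightedGraph V}

theorem NonDegenerate.heatSemigroup_le (hm : G.NonDegenerate) {C : ℝ} (hC : 0 ≤ C) {f : G.L2}
    (hf : ∀ x, f x ≤ C) (t : ℝ≥0) (x : V) : G.heatSemigroup t f x ≤ C := by
  rw [← evalL_apply]
  refine le_of_tendsto (((G.evalL x).continuous.tendsto _).comp
    (G.tendsto_exp_yosida_heatSemigroup t f)) (Eventually.of_forall fun n => ?_)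
  have h := apply_exp_smul_sub_one_le (G.resolvent (1 / ((n : ℝ) + 1))) (G.evalL x) f
    (s := t * (n + 1)) (B := 0) (B' := C) (r := 1) (by positivity) fun k => by
      rw [evalL_apply, zero_mul, zero_add]
      exact hm.resolvent_pow_le (by positivity) hC hf k x
  rw [← smul_yosida, zero_mul, zero_add] at h
  exact h

theorem NonDegenerate.heatSemigroup_nonneg (hm : G.NonDegenerate) {f : G.L2} (hf : ∀ x, 0 ≤ f x)
    (t : ℝ≥0) (x : V) : 0 ≤ G.heatSemigroup t f x := by
  have h := hm.heatSemigroup_le le_rfl (f := -f) (fun x => neg_nonpos.2 (hf x)) t x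
  rw [map_neg] at h
  exact neg_nonpos.1 h

/-- Under `CD(K,∞)` the heat semigroup hardly moves a function with small gradient. -/
theorem le_heatSemigroup_add (hm : G.NonDegenerate) {K κ : ℝ} (hCD : G.CD K) (hκ : 0 < κ)
    (hκK : 2 * |K| ≤ κ) {C : ℝ} (hC : 0 ≤ C) {f : G.L2} (hf : ∀ x, G.gam f f x ≤ C ^ 2)
    (t : ℝ≥0) (x : V) :
    f x ≤ G.heatSemigroup t f x + √(G.twiceDeg x) * C / κ * Real.exp (2 * κ * t) := by
  set A := √(G.twiceDeg x) * C / κ with hA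
  have hA0 : 0 ≤ A := by positivity
  have hlim := (((-G.evalL x).continuous.tendsto _).comp (G.tendsto_exp_yosida_heatSemigroup t f))
  have hsmall : ∀ᶠ n : ℕ in atTop, κ * (1 / ((n : ℝ) + 1)) ≤ 1 / 2 := by
    have h := (tendsto_one_div_add_atTop_nhds_zero_nat (𝕜 := ℝ)).const_mul κ
    rw [mul_zero] at h
    exact h.eventually_le_const (by norm_num)
  have hle : (-G.evalL x) (G.heatSemigroup t f) ≤ A * Real.exp (2 * κ * t) + -f x := by
    refine le_of_tendsto hlim ?_
    filter_upwards [hsmall] with n hn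
    set ε : ℝ := 1 / ((n : ℝ) + 1) with hε
    have hε0 : 0 < ε := by positivity
    have hεn : ((n : ℝ) + 1) * ε = 1 := mul_one_div_cancel (by positivity)
    have hpos : 0 < 1 - κ * ε := by linarith
    have h := apply_exp_smul_sub_one_le (G.resolvent ε) (-G.evalL x) f
      (s := t * (n + 1)) (B := A) (B' := -f x) (r := 1 / (1 - κ * ε)) (by positivity) fun k => by
        have h1 := abs_le.1 (abs_resolvent_pow_sub_le hm hCD hε0 hκ hκK hn hC hf k x)
        rw [neg_apply, evalL_apply]
        rw [mul_sub, mul_one] at h1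
        linarith [h1.1]
    rw [hε, ← smul_yosida] at h
    refine h.trans (add_le_add_left (mul_le_mul_of_nonneg_left (Real.exp_le_exp.2 ?_) hA0) _)
    -- `(n + 1) (1 / (1 - κ ε) - 1) = κ / (1 - κ ε) ≤ 2 κ` for `ε = 1 / (n + 1)`
    rw [← hε]
    have h2 : 1 / (1 - κ * ε) - 1 ≤ 2 * (κ * ε) := by
      rw [sub_le_iff_le_add, div_le_iff₀ hpos]
      have : 0 < κ * ε := by positivity
      nlinarith
    calc (t : ℝ) * (n + 1) * (1 / (1 - κ * ε) - 1) ≤ t * (n + 1) * (2 * (κ * ε)) := by gcongr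
      _ = 2 * κ * t * ((n + 1) * ε) := by ring
      _ = _ := by rw [hεn, mul_one]
  rw [neg_apply, evalL_apply] at hle
  linarith

theorem L2.eq_sum_delta (f : G.L2) {s : Finset V} (hs : ∀ x ∉ s, f x = 0) :
    f = ∑ y ∈ s, f y • G.delta y := by
  refine L2.ext fun x => ?_
  rw [← evalL_apply G x (∑ y ∈ s, f y • G.delta y), map_sum]
  simp only [map_smul, evalL_apply, smul_eq_mul]
  by_cases hx : x ∈ s
  · rw [Finset.sum_eq_single x, delta_apply_self, mul_one]
    · intro y _ hy
      rw [delta_apply_of_ne G hy.symm, mul_zero]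
    · exact fun h => absurd hx h
  · rw [hs x hx, Finset.sum_eq_zero fun y hy => ?_]
    rw [delta_apply_of_ne G (ne_of_mem_of_not_mem hy hx).symm, mul_zero]

theorem heat_one (t : ℝ≥0) (x : V) : G.heat t 1 x = ∑' y, G.heatSemigroup t (G.delta y) x := by
  refine tsum_congr fun y => ?_
  rw [Pi.one_apply, mul_one, heatKernel, div_mul_cancel₀ _ (G.m_pos y).ne']

theorem delta_nonneg (y x : V) : 0 ≤ G.delta y x :=
  Set.indicator_nonneg (fun _ _ => zero_le_one) x

theorem NonDegenerate.sum_heatSemigroup_delta_le (hm : G.NonDegenerate) (t : ℝ≥0) (x : V)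
    (s : Finset V) : ∑ y ∈ s, G.heatSemigroup t (G.delta y) x ≤ 1 := by
  have h1 : ∀ z, (∑ y ∈ s, G.delta y : G.L2) z ≤ 1 := by
    intro z
    rw [← evalL_apply, map_sum]
    simp only [evalL_apply]
    by_cases hz : z ∈ s
    · rw [Finset.sum_eq_single z, delta_apply_self]
      · exact fun y _ hy => delta_apply_of_ne G hy.symm
      · exact fun h => absurd hz h
    · rw [Finset.sum_eq_zero fun y hy => delta_apply_of_ne G (ne_of_mem_of_not_mem hy hz).symm]
      exact zero_le_one
  have h2 := hm.heatSemigroup_le zero_le_one h1 t x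
  rw [map_sum, ← evalL_apply, map_sum] at h2
  simpa only [evalL_apply] using h2

/-- `P_t f ≤ P_t 1` for finitely supported `f ≤ 1`. -/
theorem NonDegenerate.heatSemigroup_le_heat_one (hm : G.NonDegenerate) {f : G.L2}
    (hfin : (Function.support f).Finite) (hf : ∀ x, f x ≤ 1) (t : ℝ≥0) (x : V) :
    G.heatSemigroup t f x ≤ G.heat t 1 x := by
  have hnn : ∀ y, 0 ≤ G.heatSemigroup t (G.delta y) x := fun y =>
    hm.heatSemigroup_nonneg (G.delta_nonneg y) t x
  have hsum : Summable fun y => G.heatSemigroup t (G.delta y) x :=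
    summable_of_sum_le hnn (hm.sum_heatSemigroup_delta_le t x)
  have h1 : G.heatSemigroup t f x =
      ∑ y ∈ hfin.toFinset, f y * G.heatSemigroup t (G.delta y) x := by
    conv_lhs => rw [L2.eq_sum_delta f (s := hfin.toFinset) (by simp)]
    rw [map_sum, ← evalL_apply, map_sum]
    simp only [map_smul, evalL_apply, smul_eq_mul]
  rw [h1, heat_one]
  refine (Finset.sum_le_sum fun y _ => ?_).trans (hsum.sum_le_tsum hfin.toFinset fun y _ => hnn y)
  exact mul_le_of_le_one_left (hnn y) (hf y)

theorem NonDegenerate.heat_one_le (hm : G.NonDegenerate) (t : ℝ≥0) (x : V) :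
    G.heat t 1 x ≤ 1 := by
  rw [heat_one]
  exact Real.tsum_le_of_sum_le (fun y => hm.heatSemigroup_nonneg (G.delta_nonneg y) t x)
    (hm.sum_heatSemigroup_delta_le t x)

end Heat

end WeightedGraph

theorem mainTheorem2 {V : Type*} (G : WeightedGraph V) (hconn : G.Connected)
    (hcomplete : G.IsComplete) (hm : G.NonDegenerate) (hCD : ∃ K : ℝ, G.CD K) :
    G.StochasticallyComplete := by
  obtain ⟨η, hfin, hmono, hlim, hgam⟩ := hcomplete
  obtain ⟨K, hK⟩ := hCD
  intro t _
  funext x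
  refine le_antisymm (hm.heat_one_le t x) ?_
  have hle : ∀ k y, η k y ≤ 1 := fun k y =>
    Monotone.ge_of_tendsto (f := fun k => η k y) (fun i j hij => hmono hij y) (hlim y) k
  -- any `κ ≥ 2 |K|` serves; the `1` keeps it positive when `K = 0`
  set κ : ℝ := 2 * |K| + 1 with hκ
  have hκ0 : 0 < κ := by positivity
  set A := √(G.twiceDeg x) / κ * Real.exp (2 * κ * t) with hA
  have key : ∀ k : ℕ, η k x ≤ G.heat t 1 x + A * √(1 / ((k : ℝ) + 1)) := by
    intro k
    let f : G.L2 := ⟨η k, summable_of_hasFiniteSupport ((hfin k).subset fun y hy h =>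
      hy (by simp [h]))⟩
    have h1 := WeightedGraph.le_heatSemigroup_add hm hK hκ0 (by linarith)
      (Real.sqrt_nonneg (1 / ((k : ℝ) + 1))) (f := f)
      (fun y => by rw [Real.sq_sqrt (by positivity)]; exact hgam k y) t x
    have h2 := hm.heatSemigroup_le_heat_one (f := f) (hfin k) (hle k) t x
    have h3 : η k x = f x := rfl
    rw [h3]
    refine h1.trans (add_le_add h2 (le_of_eq ?_))
    rw [hA]
    ring
  have h4 := (tendsto_one_div_add_atTop_nhds_zero_nat (𝕜 := ℝ)).sqrt.const_mul A
  rw [Real.sqrt_zero, mul_zero] at h4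
  have h5 := h4.const_add (G.heat t 1 x)
  rw [add_zero] at h5
  exact le_of_tendsto_of_tendsto (hlim x) h5 (Eventually.of_forall key)
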